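/- **Conventions.** All spaces are finite-dimensional complex vector spaces. An *operator space* is such a space $X$ with a norm on $M_n(X)$ for every $n\in\mathbb N$ satisfying $\|x\oplus y\|=\max\{\|x\|,\|y\|\}$ and $\|\alpha x\beta\|\le\|\alpha\|\,\|x\|\,\|\beta\|$ for $x\in M_m(X)$, $y\in M_n(X)$ and $\alpha,\beta\in M_m(\mathbb C)$, where scalar matrices carry the operator norm; this also makes $\mathbb C$ an operator space. Rectangular matrices are normed by padding with zeros to a square. A linear map $\varphi$ is *completely contractive* if $\|[\varphi(x_{ij})]\|\le\|[x_{ij}]\|$ for all $n$ and all $[x_{ij}]\in M_n(X)$, and a *complete quotient map* if each amplification $\varphi_n$ maps the open unit ball of $M_n(X)$ onto the open unit ball of $M_n(Y)$. $X_c$ is the conjugate space of $X$ with the same matrix norms, and $X_o$ is $X$ with the matrix norms $\|[x_{ij}]\|_{M_n(X_o)}=\|[x_{ji}]\|_{M_n(X)}$. The Haagerup tensor product $X\otimes_h Y$ is $X\otimes Y$ with $\|v\|=\inf\{\|x\|\|y\| : v=[\sum_k x_{ik}\otimes y_{kj}]_{ij},\ x\in M_{n,r}(X),\ y\in M_{r,n}(Y),\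 r\in\mathbb N\}$ for $v\in M_n(X\otimes Y)$. **Coalgebras.** A (finite-dimensional) *vN-coalgebra* is a finite-dimensional operator space $C$ with completely contractive linear maps $\delta\colon C\to C\otimes_h C$, $\varepsilon\colon C\to\mathbb C$, $j\colon C_o\to C_c$ such that - $(C,\delta,\varepsilon)$ is coassociative and counital; - the antilinear map $j$ satisfies $j\circ j=\mathrm{id}$ and $\delta\circ j=(j\otimes j)\circ\gamma\circ\delta$, where $\gamma$ is the swap; - for every complete quotient map $e\colon C\to\mathbb C$ the functional $e^\sharp\colon C_o\to\mathbb C$ is a complete quotient map. Here, for a linear functional $a\colon C\to\mathbb C$, we write $a^\sharp(x)=\sum a(x_{(2)})\,\overline{a(j(x_{(1)}))}$ where $\delta(x)=\sum x_{(1)}\otimes x_{(2)}$. **Maps.** A linear map $\varphi\colon C\to D$ of vN-coalgebras is *trace-preserving* if it is counital, i.e. $\varepsilon_D\circ\varphi=\varepsilon_C$. A linear functional $p$ on $C$ is *positive* if $p=a^\sharp$ for some linear functional $a$ on $C$. A linear map $\varphi\colon C\to D$ is *positive* if $p\circ\varphi$ is positive for every positive functional $p$ on $D$. Let $T_n$ be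 the space of complex $n\times n$ matrices with $\delta(e_{ij})=\sum_k e_{kj}\otimes e_{ik}$, $\varepsilon=\mathrm{tr}$ and $j$ the conjugate transpose, and give $T_n\otimes C$ the comultiplication $(t\otimes c)\mapsto\sum (t_{(1)}\otimes c_{(1)})\otimes(t_{(2)}\otimes c_{(2)})$ and the involution $j\otimes j$. Positivity of functionals on $T_n\otimes C$ is defined by the same formula. Then $\varphi$ is *completely positive* if $\mathrm{id}_{T_n}\otimes\varphi\colon T_n\otimes C\to T_n\otimes D$ is positive for every $n\in\mathbb N$. **Proposition.** Let $\varphi\colon C_1\to C_2$ be a linear trace-preserving map between finite-dimensional vN-coalgebras. Then $\varphi$ is completely positive if and only if $\varphi$ is completely contractive. -/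

import Mathlib

open scoped TensorProduct

noncomputable section

namespace OpSp

/-! ### Operator spaces -/

/-- The operator norm of a scalar matrix acting on the Euclidean space `ℂⁿ`. -/
def opNorm {n : ℕ} (A : Matrix (Fin n) (Fin n) ℂ) : ℝ :=
  ‖Matrix.toEuclideanCLM (n := Fin n) (𝕜 := ℂ) A‖

/-- The block diagonal matrix `x ⊕ y`. -/
def blockDiag {X : Type*} [Zero X] {m n : ℕ} (x : Matrix (Fin m) (Fin m) X)
    (y : Matrix (Fin n) (Fin n) X) : Matrix (Fin (m + n)) (Fin (m + n)) X :=
  Matrix.reindex finSumFinEquiv finSumFinEquiv (Matrix.fromBlocks x 0 0 y)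

/-- The product `α x β` of a matrix `x` over `X` with scalar matrices `α`, `β`. -/
def scalarMul {X : Type*} [AddCommGroup X] [Module ℂ X] {n : ℕ}
    (α : Matrix (Fin n) (Fin n) ℂ) (x : Matrix (Fin n) (Fin n) X)
    (β : Matrix (Fin n) (Fin n) ℂ) : Matrix (Fin n) (Fin n) X :=
  Matrix.of fun i j => ∑ k, ∑ l, (α i k * β l j) • x k l

/-- An (abstract) operator space structure on a complex vector space: a norm on every matrix space
`M_n(X)`, subject to Ruan's two axioms. Completeness is not a field, because the operator spaces
below are finite dimensional. -/
class OperatorSpace (X : Type*) [AddCommGroup X] [Module ℂ X] where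
  matNorm : ∀ n : ℕ, Seminorm ℂ (Matrix (Fin n) (Fin n) X)
  eq_zero_of_matNorm : ∀ (n : ℕ) (x : Matrix (Fin n) (Fin n) X), matNorm n x = 0 → x = 0
  matNorm_blockDiag : ∀ (m n : ℕ) (x : Matrix (Fin m) (Fin m) X) (y : Matrix (Fin n) (Fin n) X),
    matNorm (m + n) (blockDiag x y) = max (matNorm m x) (matNorm n y)
  matNorm_scalarMul_le : ∀ (n : ℕ) (α : Matrix (Fin n) (Fin n) ℂ) (x : Matrix (Fin n) (Fin n) X)
    (β : Matrix (Fin n) (Fin n) ℂ),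
    matNorm n (scalarMul α x β) ≤ opNorm α * matNorm n x * opNorm β

/-- A family of real valued functions on the square matrix spaces over `X`. The matrix norm of an
operator space, of its opposite, and the Haagerup matrix norm are all given in this form, so that
complete contractions and complete quotient maps can be formulated for all of them. -/
abbrev MatGauge (X : Type*) := ∀ n : ℕ, Matrix (Fin n) (Fin n) X → ℝ

/-- The matrix norm of an operator space. It is also the matrix norm of the conjugate operator
space, whose underlying set and norms are the same and where only the scalar action differs. -/
def gauge (X : Type*) [AddCommGroup X] [Module ℂ X] [OperatorSpace X] : MatGauge X :=
  fun n x => OperatorSpace.matNorm n x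

/-- The standard matrix norm on `ℂ`. -/
def scalarGauge : MatGauge ℂ := fun _ A => opNorm A

/-- The matrix norm of the opposite operator space. -/
def opGauge {X : Type*} (N : MatGauge X) : MatGauge X := fun n x => N n x.transpose

/-- Extension of a rectangular matrix by zeros to a square matrix of size `max m n`. -/
def pad {X : Type*} [Zero X] {m n : ℕ} (x : Matrix (Fin m) (Fin n) X) :
    Matrix (Fin (max m n)) (Fin (max m n)) X :=
  Matrix.of fun i j => if h : i.1 < m ∧ j.1 < n then x ⟨i.1, h.1⟩ ⟨j.1, h.2⟩ else 0

/-- The norm of a rectangular matrix over an operator space. -/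
def rectNorm {X : Type*} [AddCommGroup X] [Module ℂ X] [OperatorSpace X] {m n : ℕ}
    (x : Matrix (Fin m) (Fin n) X) : ℝ :=
  gauge X (max m n) (pad x)

/-- The matrix inner product `(x ⊙ y) i j = ∑ k, x i k ⊗ y k j`. -/
def matInner {X Y : Type*} [AddCommGroup X] [Module ℂ X] [AddCommGroup Y] [Module ℂ Y]
    {m r n : ℕ} (x : Matrix (Fin m) (Fin r) X) (y : Matrix (Fin r) (Fin n) Y) :
    Matrix (Fin m) (Fin n) (X ⊗[ℂ] Y) :=
  Matrix.of fun i j => ∑ k, x i k ⊗ₜ[ℂ] y k j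

/-- The matrix norm of the Haagerup tensor product of two operator spaces. -/
def haagerupGauge (X Y : Type*) [AddCommGroup X] [Module ℂ X] [OperatorSpace X]
    [AddCommGroup Y] [Module ℂ Y] [OperatorSpace Y] : MatGauge (X ⊗[ℂ] Y) :=
  fun n v => sInf {c : ℝ | ∃ (r : ℕ) (x : Matrix (Fin n) (Fin r) X) (y : Matrix (Fin r) (Fin n) Y),
    v = matInner x y ∧ c = rectNorm x * rectNorm y}

/-- Every amplification of `f` is contractive for the given matrix norms. -/
def IsCC {X Y : Type*} (N : MatGauge X) (M : MatGauge Y) (f : X → Y) : Prop :=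
  ∀ (n : ℕ) (x : Matrix (Fin n) (Fin n) X), M n (x.map f) ≤ N n x

/-- Every amplification of `f` maps the open unit ball onto the open unit ball. -/
def IsCQ {X Y : Type*} (N : MatGauge X) (M : MatGauge Y) (f : X → Y) : Prop :=
  ∀ n : ℕ, (fun x : Matrix (Fin n) (Fin n) X => x.map f) '' {x | N n x < 1} = {y | M n y < 1}

/-! ### von Neumann coalgebras -/

/-- A vector space with a distinguished antilinear self-map, the datum of the involution
`j : C_o → C_c` of a von Neumann coalgebra. -/
class CoInvolution (C : Type*) [AddCommGroup C] [Module ℂ C] where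
  coinv : C →ₛₗ[starRingEnd ℂ] C

/-- Complex conjugation as an antilinear map. -/
def conjMap : ℂ →ₛₗ[starRingEnd ℂ] ℂ where
  toFun := starRingEnd ℂ
  map_add' := map_add _
  map_smul' := fun a b => by simp

/-- The composite
`C_o → (C ⊗ C)_o → C_o ⊗ C_o → C_o ⊗ C_c → ℂ_o ⊗ ℂ_c ≅ ℂ` of the comultiplication, the swap,
`id ⊗ j`, `a ⊗ a` and `z ⊗ w ↦ z * conj w`. If the comultiplication sends `x` to `∑ u ⊗ v`, then
the value at `x` is `∑ a v * conj (a (j u))`. -/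
def coSquare {C : Type*} [AddCommGroup C] [Module ℂ C] [CoalgebraStruct ℂ C] [CoInvolution C]
    (a : C →ₗ[ℂ] ℂ) : C →ₗ[ℂ] ℂ :=
  LinearMap.mul' ℂ ℂ ∘ₗ
    TensorProduct.map a ((conjMap.comp (a.comp CoInvolution.coinv) : C →ₗ[ℂ] ℂ)) ∘ₗ
    (TensorProduct.comm ℂ C C).toLinearMap ∘ₗ CoalgebraStruct.comul

/-- A finite-dimensional von Neumann coalgebra: an operator space `C` which is a comonoid for the
Haagerup tensor product (the comonoid equations are those of a coalgebra over `ℂ`, the structure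
maps are complete contractions), with a completely contractive involution `C_o → C_c` that reverses
the comultiplication, and such that `coSquare e : C_o → ℂ` is a complete quotient map whenever
`e : C → ℂ` is one. -/
class VNCoalgebra (C : Type*) [AddCommGroup C] [Module ℂ C] [FiniteDimensional ℂ C]
    extends OperatorSpace C, Coalgebra ℂ C, CoInvolution C where
  comul_cc : IsCC (gauge C) (haagerupGauge C C) (CoalgebraStruct.comul (R := ℂ) (A := C))
  counit_cc : IsCC (gauge C) scalarGauge (CoalgebraStruct.counit (R := ℂ) (A := C))
  coinv_cc : IsCC (opGauge (gauge C)) (gauge C) coinv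
  coinv_coinv : ∀ x : C, coinv (coinv x) = x
  comul_coinv : ∀ x : C, CoalgebraStruct.comul (R := ℂ) (coinv x) =
    TensorProduct.map coinv coinv
      (TensorProduct.comm ℂ C C (CoalgebraStruct.comul (R := ℂ) x))
  coSquare_cq : ∀ e : C →ₗ[ℂ] ℂ, IsCQ (gauge C) scalarGauge e →
    IsCQ (opGauge (gauge C)) scalarGauge (coSquare e)

/-! ### The trace class coalgebra and tensor products

Positivity of functionals and of maps only involves comultiplications and involutions, no norms, so
only this part of the structure of `T_n` and of `T_n ⊗ C` is recorded. -/

/-- The space `T_n` of complex `n × n` matrices, thought of as trace class operators. -/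
def TraceClass (n : ℕ) : Type := Matrix (Fin n) (Fin n) ℂ

namespace TraceClass

instance (n : ℕ) : AddCommGroup (TraceClass n) :=
  inferInstanceAs (AddCommGroup (Matrix (Fin n) (Fin n) ℂ))

instance (n : ℕ) : Module ℂ (TraceClass n) :=
  inferInstanceAs (Module ℂ (Matrix (Fin n) (Fin n) ℂ))

/-- The matrix unit `e_ij`. -/
def unit {n : ℕ} (i j : Fin n) : TraceClass n := Matrix.single i j (1 : ℂ)

/-- The basis of matrix units. -/
def basis (n : ℕ) : Module.Basis (Fin n × Fin n) ℂ (TraceClass n) :=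
  Matrix.stdBasis ℂ (Fin n) (Fin n)

theorem basis_apply {n : ℕ} (p : Fin n × Fin n) : basis n p = unit p.1 p.2 :=
  Matrix.stdBasis_eq_single ℂ p.1 p.2

/-- The comultiplication `e_ij ↦ ∑ k, e_kj ⊗ e_ik`, and the trace as counit. -/
instance (n : ℕ) : CoalgebraStruct ℂ (TraceClass n) where
  comul := (basis n).constr ℂ fun p => ∑ k, unit k p.2 ⊗ₜ[ℂ] unit p.1 k
  counit := Matrix.traceLinearMap (Fin n) ℂ ℂ

theorem comul_unit {n : ℕ} (i j : Fin n) :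
    CoalgebraStruct.comul (R := ℂ) (unit i j) = ∑ k, unit k j ⊗ₜ[ℂ] unit i k := by
  have h := (basis n).constr_basis ℂ (fun p => ∑ k, unit k p.2 ⊗ₜ[ℂ] unit p.1 k) (i, j)
  rwa [basis_apply] at h

theorem counit_unit {n : ℕ} (i j : Fin n) :
    CoalgebraStruct.counit (R := ℂ) (unit i j) = if i = j then (1 : ℂ) else 0 := by
  change Matrix.trace (Matrix.single i j (1 : ℂ)) = _
  split_ifs with h
  · subst h; simp
  · exact Matrix.trace_single_eq_of_ne i j 1 h

instance (n : ℕ) : Coalgebra ℂ (TraceClass n) where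
  coassoc := by
    refine (basis n).ext fun p => ?_
    simp only [basis_apply, LinearMap.comp_apply, comul_unit, map_sum, LinearMap.rTensor_tmul,
      LinearMap.lTensor_tmul, TensorProduct.sum_tmul, TensorProduct.tmul_sum,
      LinearEquiv.coe_coe, TensorProduct.assoc_tmul]
    exact Finset.sum_comm
  rTensor_counit_comp_comul := by
    refine (basis n).ext fun p => ?_
    simp [basis_apply, comul_unit, counit_unit, TensorProduct.ite_tmul]
  lTensor_counit_comp_comul := by
    refine (basis n).ext fun p => ?_
    simp [basis_apply, comul_unit, counit_unit, TensorProduct.tmul_ite]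

/-- The involution is the conjugate transpose. -/
instance (n : ℕ) : CoInvolution (TraceClass n) where
  coinv :=
    { toFun := fun t => Matrix.conjTranspose t
      map_add' := fun s t => Matrix.conjTranspose_add s t
      map_smul' := fun c t => Matrix.conjTranspose_smul c t }

end TraceClass

/-- The involution `j ⊗ j` on a tensor product. The comultiplication and the counit are those of
the tensor product of coalgebras in Mathlib. -/
instance {C D : Type*} [AddCommGroup C] [Module ℂ C] [CoInvolution C]
    [AddCommGroup D] [Module ℂ D] [CoInvolution D] : CoInvolution (C ⊗[ℂ] D) where
  coinv := TensorProduct.map CoInvolution.coinv CoInvolution.coinv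

/-! ### Positivity and the classes of maps in the statement -/

/-- A linear functional `p` is positive if `p = coSquare a` for some linear functional `a`. -/
def IsPositiveFunctional {C : Type*} [AddCommGroup C] [Module ℂ C] [CoalgebraStruct ℂ C]
    [CoInvolution C] (p : C →ₗ[ℂ] ℂ) : Prop :=
  ∃ a : C →ₗ[ℂ] ℂ, p = coSquare a

/-- A linear map is positive if it reflects positive functionals. -/
def IsPositiveMap {C D : Type*} [AddCommGroup C] [Module ℂ C] [CoalgebraStruct ℂ C]
    [CoInvolution C] [AddCommGroup D] [Module ℂ D] [CoalgebraStruct ℂ D] [CoInvolution D]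
    (φ : C →ₗ[ℂ] D) : Prop :=
  ∀ p : D →ₗ[ℂ] ℂ, IsPositiveFunctional p → IsPositiveFunctional (p ∘ₗ φ)

/-- `φ` is completely positive if `T_n ⊗ φ : T_n ⊗ C → T_n ⊗ D` is positive for all `n`. -/
def IsCompletelyPositive {C D : Type*} [AddCommGroup C] [Module ℂ C] [Coalgebra ℂ C]
    [CoInvolution C] [AddCommGroup D] [Module ℂ D] [Coalgebra ℂ D] [CoInvolution D]
    (φ : C →ₗ[ℂ] D) : Prop :=
  ∀ n : ℕ, IsPositiveMap (φ.lTensor (TraceClass n))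

/-- `φ` is completely contractive. -/
def IsCompletelyContractive {X Y : Type*} [AddCommGroup X] [Module ℂ X] [OperatorSpace X]
    [AddCommGroup Y] [Module ℂ Y] [OperatorSpace Y] (φ : X →ₗ[ℂ] Y) : Prop :=
  IsCC (gauge X) (gauge Y) φ

/-- `φ` is trace-preserving, that is, counital. -/
def IsTracePreserving {C D : Type*} [AddCommGroup C] [Module ℂ C] [CoalgebraStruct ℂ C]
    [AddCommGroup D] [Module ℂ D] [CoalgebraStruct ℂ D] (φ : C →ₗ[ℂ] D) : Prop :=
  ∀ x : C, CoalgebraStruct.counit (R := ℂ) (φ x) = CoalgebraStruct.counit (R := ℂ) x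

end OpSp

end

noncomputable section

open scoped Matrix.Norms.L2Operator Kronecker

set_option linter.unusedSectionVars false

/-! ### Norms of scalar matrices -/

namespace ScalarMatrix

open Matrix

variable {l m n o : Type*} [Fintype l] [Fintype m] [Fintype n] [Fintype o]
  [DecidableEq l] [DecidableEq m] [DecidableEq n] [DecidableEq o]

/-! The proof passes to the dual. Functionals on a vN-coalgebra `C` form a C⋆-algebra `DualAlg C`:
convolution is the product, the counit is the unit, the involution gives the star, and the axiom on
`coSquare` gives the C⋆-inequality for the dual norm. A functional on `T_n ⊗ C` is an `n × n` matrix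
over `DualAlg C`, and `coSquare` becomes `star b * b`; hence `φ` is completely positive iff all
amplifications of `dualMap φ` are positive. Trace preservation says that `dualMap φ` is unital.

To dualise complete contractivity as well, two facts are needed. First, the completely bounded norm
of a matrix of functionals equals its C⋆-norm (`isCB_iff_norm_le`). The cb norm is submultiplicative
and star-invariant, and it dominates the C⋆-norm up to a constant, which powers of `star f * f`
remove. Conversely, self-adjoint `f` satisfy `‖1 + itf‖_cb ≤ 1 + ct²`; so the group `cos s + i sin s
W` of a symmetry `W` is cb-contractive, and therefore so is `W`. Unitaries are corners of
symmetries, self-adjoint contractions are averages of unitaries, and contractions are corners of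
self-adjoint ones. Second, the matrix norms of `C` are recovered from cb-contractive matrices of
functionals (`exists_isCB_gauge_le`), by a Hahn–Banach argument in the style of Ruan's theorem.

What remains is C⋆-theory at each matrix level: a unital map with positive amplifications is
contractive (`norm_mapₗ_le_norm`), and a unital contraction is positive
(`map_nonneg_of_contractive`). -/

theorem norm_one_le : ‖(1 : Matrix n n ℂ)‖ ≤ 1 := by
  rcases isEmpty_or_nonempty n with h | h
  · rw [Subsingleton.elim (1 : Matrix n n ℂ) 0]; simp
  · exact CStarRing.norm_one.le

/-- The isometry given by an injection of index sets. -/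
def incl (f : l → n) : Matrix n l ℂ := (1 : Matrix n n ℂ).submatrix id f

theorem incl_conjTranspose_mul_incl {f : l → n} (hf : Function.Injective f) :
    (incl f)ᴴ * incl f = 1 := by
  ext i j
  simp [incl, Matrix.mul_apply, Matrix.one_apply, hf.eq_iff]

theorem norm_incl_le {f : l → n} (hf : Function.Injective f) : ‖incl f‖ ≤ 1 := by
  have h := l2_opNorm_conjTranspose_mul_self (incl f)
  rw [incl_conjTranspose_mul_incl hf] at h
  nlinarith [norm_one_le (n := l), norm_nonneg (incl f)]

theorem submatrix_eq (A : Matrix m n ℂ) (f : l → m) (g : o → n) :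
    A.submatrix f g = (incl f)ᴴ * A * incl g := by
  ext i j
  simp [incl, Matrix.mul_apply, Matrix.one_apply]

theorem norm_submatrix_le (A : Matrix m n ℂ) {f : l → m} {g : o → n}
    (hf : Function.Injective f) (hg : Function.Injective g) : ‖A.submatrix f g‖ ≤ ‖A‖ := by
  rw [submatrix_eq]
  calc _ ≤ ‖(incl f)ᴴ * A‖ * ‖incl g‖ := l2_opNorm_mul _ _
    _ ≤ (‖(incl f)ᴴ‖ * ‖A‖) * 1 := by
      gcongr
      · exact l2_opNorm_mul _ _
      · exact norm_incl_le hg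
    _ ≤ (1 * ‖A‖) * 1 := by
      gcongr
      rw [l2_opNorm_conjTranspose]
      exact norm_incl_le hf
    _ = ‖A‖ := by ring

theorem norm_submatrix_equiv (A : Matrix m n ℂ) (f : l ≃ m) (g : o ≃ n) :
    ‖A.submatrix f g‖ = ‖A‖ := by
  refine le_antisymm (norm_submatrix_le A f.injective g.injective) ?_
  have h := norm_submatrix_le (A.submatrix f g) f.symm.injective g.symm.injective
  simpa using h

/-- Extension by zero along injections of the index sets does not increase the norm. -/
theorem norm_extend_le (A : Matrix l o ℂ) {f : l → m} {g : o → n}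
    (hf : Function.Injective f) (hg : Function.Injective g) :
    ‖incl f * A * (incl g)ᴴ‖ ≤ ‖A‖ := by
  calc _ ≤ ‖incl f * A‖ * ‖(incl g)ᴴ‖ := l2_opNorm_mul _ _
    _ ≤ (‖incl f‖ * ‖A‖) * 1 := by
      gcongr
      · exact l2_opNorm_mul _ _
      · rw [l2_opNorm_conjTranspose]; exact norm_incl_le hg
    _ ≤ (1 * ‖A‖) * 1 := by
      gcongr
      exact norm_incl_le hf
    _ = ‖A‖ := by ring

theorem norm_fromBlocks_zero₁₂ (A : Matrix l o ℂ) :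
    ‖(fromBlocks 0 A 0 0 : Matrix (l ⊕ m) (n ⊕ o) ℂ)‖ ≤ ‖A‖ := by
  have h := norm_extend_le A (Sum.inl_injective (α := l) (β := m))
    (Sum.inr_injective (α := n) (β := o))
  convert h using 2
  ext (i | i) (j | j) <;> simp [incl, Matrix.mul_apply, Matrix.one_apply]

theorem norm_fromBlocks_zero₂₁ (A : Matrix m n ℂ) :
    ‖(fromBlocks 0 0 A 0 : Matrix (l ⊕ m) (n ⊕ o) ℂ)‖ ≤ ‖A‖ := by
  have h := norm_extend_le A (Sum.inr_injective (α := l) (β := m))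
    (Sum.inl_injective (α := n) (β := o))
  convert h using 2
  ext (i | i) (j | j) <;> simp [incl, Matrix.mul_apply, Matrix.one_apply]

theorem norm_entry_le (A : Matrix m n ℂ) (i : m) (j : n) : ‖A i j‖ ≤ ‖A‖ := by
  have h := norm_submatrix_le A (f := fun _ : Unit => i) (g := fun _ : Unit => j)
    (Function.injective_of_subsingleton _) (Function.injective_of_subsingleton _)
  have h2 : A.submatrix (fun _ : Unit => i) (fun _ : Unit => j) = diagonal fun _ => A i j := by
    ext a b; simp
  rw [h2, l2_opNorm_diagonal] at h
  simpa using h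

theorem sum_star_mul_mul (A : Matrix m n ℂ) (v : EuclideanSpace ℂ m) (w : EuclideanSpace ℂ n) :
    ∑ i, ∑ j, star (v i) * A i j * w j = inner ℂ v (WithLp.toLp 2 (A *ᵥ w.ofLp)) := by
  rw [PiLp.inner_apply]
  refine Finset.sum_congr rfl fun i _ => ?_
  change _ = (∑ j, A i j * w j) * starRingEnd ℂ (v i)
  rw [Finset.sum_mul]
  refine Finset.sum_congr rfl fun j _ => ?_
  rw [starRingEnd_apply]
  ring

theorem norm_sesq_le (A : Matrix m n ℂ) (v : EuclideanSpace ℂ m) (w : EuclideanSpace ℂ n) :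
    ‖∑ i, ∑ j, star (v i) * A i j * w j‖ ≤ ‖A‖ * ‖v‖ * ‖w‖ := by
  rw [sum_star_mul_mul]
  refine (norm_inner_le_norm _ _).trans ?_
  calc _ ≤ ‖v‖ * (‖A‖ * ‖w‖) := by gcongr; exact l2_opNorm_mulVec A w
    _ = _ := by ring

/-- A bound on the sesquilinear form of a matrix bounds its norm. -/
theorem norm_le_of_forall_sesq_le (A : Matrix m n ℂ) {K : ℝ} (hK : 0 ≤ K)
    (h : ∀ (v : EuclideanSpace ℂ m) (w : EuclideanSpace ℂ n),
      ‖∑ i, ∑ j, star (v i) * A i j * w j‖ ≤ K * ‖v‖ * ‖w‖) : ‖A‖ ≤ K := by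
  rw [l2_opNorm_def]
  refine ContinuousLinearMap.opNorm_le_bound _ hK fun w => ?_
  set u : EuclideanSpace ℂ m := WithLp.toLp 2 (A *ᵥ w.ofLp) with hu
  change ‖u‖ ≤ _
  have h2 := h u w
  rw [sum_star_mul_mul, ← hu, ← inner_self_re_eq_norm, inner_self_eq_norm_mul_norm] at h2
  rcases eq_or_lt_of_le (norm_nonneg u) with h0 | h0
  · rw [← h0]; positivity
  · nlinarith

end ScalarMatrix

namespace OpSp

open Matrix ScalarMatrix

theorem opNorm_eq {n : ℕ} (A : Matrix (Fin n) (Fin n) ℂ) : opNorm A = ‖A‖ := rfl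

/-! ### Matrix norms of an operator space -/

section OperatorSpace

variable {X : Type*} [AddCommGroup X] [Module ℂ X]

/-- The product `α x β` for rectangular scalar matrices. -/
def rectMul {n m m' n' : ℕ} (α : Matrix (Fin n) (Fin m) ℂ) (x : Matrix (Fin m) (Fin m') X)
    (β : Matrix (Fin m') (Fin n') ℂ) : Matrix (Fin n) (Fin n') X :=
  of fun i j => ∑ k, ∑ l, (α i k * β l j) • x k l

theorem blockDiag_castAdd_castAdd {m n : ℕ} (x : Matrix (Fin m) (Fin m) X)
    (y : Matrix (Fin n) (Fin n) X) (i j : Fin m) :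
    blockDiag x y (Fin.castAdd n i) (Fin.castAdd n j) = x i j := by
  simp [blockDiag]

theorem blockDiag_natAdd_natAdd {m n : ℕ} (x : Matrix (Fin m) (Fin m) X)
    (y : Matrix (Fin n) (Fin n) X) (i j : Fin n) :
    blockDiag x y (Fin.natAdd m i) (Fin.natAdd m j) = y i j := by
  simp [blockDiag]

theorem blockDiag_castAdd_natAdd {m n : ℕ} (x : Matrix (Fin m) (Fin m) X)
    (y : Matrix (Fin n) (Fin n) X) (i : Fin m) (j : Fin n) :
    blockDiag x y (Fin.castAdd n i) (Fin.natAdd m j) = 0 := by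
  simp [blockDiag]

theorem blockDiag_natAdd_castAdd {m n : ℕ} (x : Matrix (Fin m) (Fin m) X)
    (y : Matrix (Fin n) (Fin n) X) (i : Fin n) (j : Fin m) :
    blockDiag x y (Fin.natAdd m i) (Fin.castAdd n j) = 0 := by
  simp [blockDiag]

variable [OperatorSpace X]

theorem gauge_nonneg (n : ℕ) (x : Matrix (Fin n) (Fin n) X) : 0 ≤ gauge X n x :=
  apply_nonneg _ _

theorem gauge_add_le (n : ℕ) (x y : Matrix (Fin n) (Fin n) X) :
    gauge X n (x + y) ≤ gauge X n x + gauge X n y := map_add_le_add _ _ _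

theorem gauge_smul (n : ℕ) (c : ℂ) (x : Matrix (Fin n) (Fin n) X) :
    gauge X n (c • x) = ‖c‖ * gauge X n x := map_smul_eq_mul _ _ _

theorem gauge_zero (n : ℕ) : gauge X n 0 = 0 := map_zero _

theorem gauge_blockDiag (m n : ℕ) (x : Matrix (Fin m) (Fin m) X) (y : Matrix (Fin n) (Fin n) X) :
    gauge X (m + n) (blockDiag x y) = max (gauge X m x) (gauge X n y) :=
  OperatorSpace.matNorm_blockDiag m n x y

/-- Ruan's axiom covers square scalar matrices only, so `α` and `β` are placed in off-diagonal
corners of size `n + m`, where they move the block `x` into the block `α x β`. -/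
theorem gauge_rectMul_le {n m : ℕ} (α : Matrix (Fin n) (Fin m) ℂ) (x : Matrix (Fin m) (Fin m) X)
    (β : Matrix (Fin m) (Fin n) ℂ) :
    gauge X n (rectMul α x β) ≤ ‖α‖ * gauge X m x * ‖β‖ := by
  set a : Matrix (Fin (n + m)) (Fin (n + m)) ℂ :=
    (fromBlocks 0 α 0 0).submatrix finSumFinEquiv.symm finSumFinEquiv.symm with ha
  set b : Matrix (Fin (n + m)) (Fin (n + m)) ℂ :=
    (fromBlocks 0 0 β 0).submatrix finSumFinEquiv.symm finSumFinEquiv.symm with hb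
  have h1 : blockDiag (rectMul α x β) (0 : Matrix (Fin m) (Fin m) X) =
      scalarMul a (blockDiag (0 : Matrix (Fin n) (Fin n) X) x) b := by
    ext i j
    simp only [scalarMul, of_apply, Fin.sum_univ_add, blockDiag_castAdd_castAdd,
      blockDiag_natAdd_natAdd, blockDiag_natAdd_castAdd, blockDiag_castAdd_natAdd, Matrix.zero_apply,
      smul_zero, Finset.sum_const_zero, zero_add, add_zero]
    refine Fin.addCases (fun i => ?_) (fun i => ?_) i <;>
      refine Fin.addCases (fun j => ?_) (fun j => ?_) j <;>
      simp [blockDiag, ha, hb, rectMul]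
  have h2 := OperatorSpace.matNorm_scalarMul_le (n + m) a
    (blockDiag (0 : Matrix (Fin n) (Fin n) X) x) b
  rw [← h1, OperatorSpace.matNorm_blockDiag, OperatorSpace.matNorm_blockDiag, map_zero, map_zero,
    max_eq_left (apply_nonneg _ _), max_eq_right (apply_nonneg _ _)] at h2
  refine h2.trans ?_
  rw [opNorm_eq, opNorm_eq]
  have hx := gauge_nonneg m x
  have e1 : ‖a‖ ≤ ‖α‖ := by
    rw [ha, norm_submatrix_equiv]; exact norm_fromBlocks_zero₁₂ α
  have e2 : ‖b‖ ≤ ‖β‖ := by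
    rw [hb, norm_submatrix_equiv]; exact norm_fromBlocks_zero₂₁ β
  change _ * gauge X m x * _ ≤ _
  gcongr

/-- The norm of an element, regarded as a `1 × 1` matrix. -/
def norm₁ (c : X) : ℝ := gauge X 1 (of fun _ _ => c)

/-- Compression by a row and a column reduces every matrix level to the first. This is why
functionals are automatically completely bounded. -/
theorem norm₁_compress_le {m : ℕ} (x : Matrix (Fin m) (Fin m) X) (v w : EuclideanSpace ℂ (Fin m)) :
    norm₁ (∑ k, ∑ l, (star (v k) * w l) • x k l) ≤ ‖v‖ * ‖w‖ * gauge X m x := by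
  have key : ∀ u : EuclideanSpace ℂ (Fin m),
      ‖(of fun i (_ : Fin 1) => u i : Matrix (Fin m) (Fin 1) ℂ)‖ ≤ ‖u‖ := fun u => by
    refine norm_le_of_forall_sesq_le _ (norm_nonneg _) fun a b => ?_
    have : ∑ i, ∑ j, star (a i) * (of fun i (_ : Fin 1) => u i : Matrix (Fin m) (Fin 1) ℂ) i j * b j
        = inner ℂ a u * b 0 := by
      simp [PiLp.inner_apply, Finset.mul_sum, mul_comm]
    rw [this, norm_mul]
    have h2 : ‖b 0‖ ≤ ‖b‖ := PiLp.norm_apply_le b 0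
    calc _ ≤ (‖a‖ * ‖u‖) * ‖b‖ := by
          gcongr
          exact norm_inner_le_norm _ _
      _ = _ := by ring
  have h := gauge_rectMul_le (of fun i (_ : Fin 1) => v i : Matrix (Fin m) (Fin 1) ℂ)ᴴ x
    (of fun i (_ : Fin 1) => w i)
  have e : rectMul (of fun i (_ : Fin 1) => v i : Matrix (Fin m) (Fin 1) ℂ)ᴴ x
    (of fun i (_ : Fin 1) => w i) = of fun _ _ => ∑ k, ∑ l, (star (v k) * w l) • x k l := by
    ext i j; simp [rectMul]
  rw [e, l2_opNorm_conjTranspose] at h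
  have hx := gauge_nonneg m x
  refine h.trans ?_
  calc _ ≤ ‖v‖ * gauge X m x * ‖w‖ := by gcongr <;> exact key _
    _ = _ := by ring

/-- A functional bounded on the first matrix level is completely bounded with the same bound. -/
theorem norm_map_functional_le (a : X →ₗ[ℂ] ℂ) {K : ℝ} (hK : 0 ≤ K)
    (ha : ∀ c, ‖a c‖ ≤ K * norm₁ c) {m : ℕ} (x : Matrix (Fin m) (Fin m) X) :
    ‖x.map a‖ ≤ K * gauge X m x := by
  refine norm_le_of_forall_sesq_le _ (mul_nonneg hK (gauge_nonneg _ _)) fun v w => ?_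
  have h := ha (∑ k, ∑ l, (star (v k) * w l) • x k l)
  have e : a (∑ k, ∑ l, (star (v k) * w l) • x k l) =
      ∑ k, ∑ l, star (v k) * (x.map a) k l * w l := by
    simp only [map_sum, map_smul, smul_eq_mul, map_apply]
    exact Finset.sum_congr rfl fun k _ => Finset.sum_congr rfl fun l _ => by ring
  rw [← e]
  refine h.trans ?_
  calc _ ≤ K * (‖v‖ * ‖w‖ * gauge X m x) := by gcongr; exact norm₁_compress_le x v w
    _ = _ := by ring

theorem gauge_one (x : Matrix (Fin 1) (Fin 1) X) : gauge X 1 x = norm₁ (x 0 0) := by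
  unfold norm₁
  congr 1
  ext i j
  simp [Subsingleton.elim i 0, Subsingleton.elim j 0]

theorem norm₁_nonneg (c : X) : 0 ≤ norm₁ c := gauge_nonneg _ _

theorem norm₁_smul (z : ℂ) (c : X) : norm₁ (z • c) = ‖z‖ * norm₁ c := by
  unfold norm₁
  rw [← gauge_smul]; rfl

theorem norm₁_add_le (c d : X) : norm₁ (c + d) ≤ norm₁ c + norm₁ d := by
  unfold norm₁
  rw [show (of fun _ _ => c + d : Matrix (Fin 1) (Fin 1) X) = (of fun _ _ => c) + of fun _ _ => d
    from rfl]
  exact gauge_add_le _ _ _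

theorem norm₁_eq_zero {c : X} (h : norm₁ c = 0) : c = 0 :=
  congrFun (congrFun (OperatorSpace.eq_zero_of_matNorm 1 _ h) 0) 0

/-- The scalar multiples of one element form a copy of a matrix algebra. -/
theorem gauge_smul_const_le {n : ℕ} (α : Matrix (Fin n) (Fin n) ℂ) (c : X) :
    gauge X n (of fun i j => α i j • c) ≤ ‖α‖ * norm₁ c := by
  -- The diagonal matrix `c ⊕ ⋯ ⊕ c` is controlled by the block-sum axiom; multiplying it by `α`
  -- gives the general case.
  have hd : ∀ k : ℕ, gauge X k (of fun i j => if i = j then c else 0) ≤ norm₁ c := by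
    intro k
    induction k with
    | zero =>
      rw [show (of fun i j : Fin 0 => if i = j then c else 0) = 0 from by ext i; exact i.elim0,
        gauge_zero]
      exact norm₁_nonneg c
    | succ k ih =>
      have e : (of fun i j : Fin (k + 1) => if i = j then c else 0) =
          blockDiag (of fun i j : Fin k => if i = j then c else 0)
            (of fun _ _ => c : Matrix (Fin 1) (Fin 1) X) := by
        ext i j
        refine Fin.addCases (fun i => ?_) (fun i => ?_) i <;>
          refine Fin.addCases (fun j => ?_) (fun j => ?_) j
        · simp [blockDiag]
        · rw [blockDiag_castAdd_natAdd, of_apply, if_neg]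
          intro h; have := congrArg Fin.val h; simp at this; omega
        · rw [blockDiag_natAdd_castAdd, of_apply, if_neg]
          intro h; have := congrArg Fin.val h; simp at this; omega
        · rw [blockDiag_natAdd_natAdd, of_apply, if_pos (by rw [Subsingleton.elim i j])]
          rfl
      rw [e, gauge_blockDiag]
      exact max_le ih le_rfl
  have h := gauge_rectMul_le α (of fun i j : Fin n => if i = j then c else 0) 1
  have e : rectMul α (of fun i j : Fin n => if i = j then c else 0) 1 =
      of fun i j => α i j • c := by
    ext i j
    simp [rectMul, one_apply]
  rw [e] at h
  refine h.trans ?_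
  have hc := norm₁_nonneg c
  calc _ ≤ ‖α‖ * norm₁ c * 1 := by
        gcongr
        · exact hd n
        · exact norm_one_le
    _ = _ := by ring

end OperatorSpace

/-! ### The convolution algebra of functionals -/

/-- The space of functionals, with the convolution product. -/
def DualAlg (C : Type*) [AddCommGroup C] [Module ℂ C] : Type _ := WithConv (C →ₗ[ℂ] ℂ)

namespace DualAlg

section Algebraic

variable {C : Type*} [AddCommGroup C] [Module ℂ C]

instance [Coalgebra ℂ C] : Ring (DualAlg C) := inferInstanceAs (Ring (WithConv (C →ₗ[ℂ] ℂ)))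
instance [Coalgebra ℂ C] : Algebra ℂ (DualAlg C) :=
  inferInstanceAs (Algebra ℂ (WithConv (C →ₗ[ℂ] ℂ)))

variable [Coalgebra ℂ C]

/-- The functional underlying an element of the convolution algebra. -/
def toDual : DualAlg C ≃ₗ[ℂ] (C →ₗ[ℂ] ℂ) where
  toFun a := WithConv.ofConv a
  invFun a := WithConv.toConv a
  map_add' _ _ := rfl
  map_smul' _ _ := rfl
  left_inv _ := rfl
  right_inv _ := rfl

theorem ext_apply {a b : DualAlg C} (h : ∀ c, toDual a c = toDual b c) : a = b :=
  toDual.injective (LinearMap.ext h)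

theorem toDual_mul (a b : DualAlg C) (c : C) : toDual (a * b) c =
    LinearMap.mul' ℂ ℂ (TensorProduct.map (toDual a) (toDual b) (CoalgebraStruct.comul c)) := rfl

end Algebraic

variable {C : Type*} [AddCommGroup C] [Module ℂ C] [FiniteDimensional ℂ C] [VNCoalgebra C]

instance : Star (DualAlg C) where
  star a := toDual.symm (conjMap.comp ((toDual a).comp CoInvolution.coinv) : C →ₗ[ℂ] ℂ)

theorem toDual_star (a : DualAlg C) (c : C) :
    toDual (star a) c = star (toDual a (CoInvolution.coinv c)) := rfl

instance : StarRing (DualAlg C) where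
  star_involutive a := ext_apply fun c => by
    rw [toDual_star, toDual_star, star_star, VNCoalgebra.coinv_coinv]
  star_add a b := ext_apply fun c => by
    rw [toDual_star, map_add, map_add, LinearMap.add_apply, LinearMap.add_apply, star_add]; rfl
  star_mul a b := ext_apply fun c => by
    rw [toDual_star, toDual_mul, toDual_mul, VNCoalgebra.comul_coinv]
    induction (CoalgebraStruct.comul c : C ⊗[ℂ] C) with
    | zero => simp
    | add x y hx hy => simp only [map_add, star_add, hx, hy]
    | tmul x y =>
      simp only [TensorProduct.comm_tmul, TensorProduct.map_tmul, LinearMap.mul'_apply,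
        toDual_star, star_mul]

instance : StarModule ℂ (DualAlg C) where
  star_smul z a := ext_apply fun c => by
    rw [toDual_star, map_smul, map_smul, LinearMap.smul_apply, LinearMap.smul_apply, toDual_star,
      star_smul]

/-- This identity turns the `coSquare` axiom into the C⋆-condition. -/
theorem toDual_star_mul_self (a : DualAlg C) : toDual (star a * a) = coSquare (toDual a) := by
  ext c
  rw [toDual_mul]
  simp only [coSquare, LinearMap.comp_apply, LinearEquiv.coe_coe]
  induction (CoalgebraStruct.comul c : C ⊗[ℂ] C) with
  | zero => simp
  | add x y hx hy => simp only [map_add, hx, hy]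
  | tmul x y =>
    simp only [TensorProduct.comm_tmul, TensorProduct.map_tmul, LinearMap.mul'_apply]
    rw [mul_comm]; rfl

end DualAlg

/-! ### Complete boundedness of matrices of functionals -/

section IsCB

variable {C : Type*} [AddCommGroup C] [Module ℂ C] [Coalgebra ℂ C]
variable {ι κ : Type*} [Fintype ι] [DecidableEq ι] [Fintype κ] [DecidableEq κ]

open DualAlg

/-- The scalar matrix obtained by applying a matrix of functionals to a matrix of elements. -/
def amp (f : CStarMatrix ι κ (DualAlg C)) {m n : ℕ} (x : Matrix (Fin m) (Fin n) C) :
    Matrix (Fin m × ι) (Fin n × κ) ℂ :=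
  of fun p q => toDual (f p.2 q.2) (x p.1 q.1)

theorem amp_apply (f : CStarMatrix ι κ (DualAlg C)) {m n : ℕ} (x : Matrix (Fin m) (Fin n) C)
    (p : Fin m × ι) (q : Fin n × κ) : amp f x p q = toDual (f p.2 q.2) (x p.1 q.1) := rfl

theorem amp_add (f g : CStarMatrix ι κ (DualAlg C)) {m n : ℕ} (x : Matrix (Fin m) (Fin n) C) :
    amp (f + g) x = amp f x + amp g x := by
  ext p q; simp [amp_apply]

theorem amp_smul (z : ℂ) (f : CStarMatrix ι κ (DualAlg C)) {m n : ℕ}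
    (x : Matrix (Fin m) (Fin n) C) : amp (z • f) x = z • amp f x := by
  ext p q; simp [amp_apply]

/-- The image of a tensor that is a matrix inner product under a pair of functionals. -/
theorem mul'_map_matInner (a b : C →ₗ[ℂ] ℂ) {m r n : ℕ} (u : Matrix (Fin m) (Fin r) C)
    (v : Matrix (Fin r) (Fin n) C) (k : Fin m) (l : Fin n) :
    LinearMap.mul' ℂ ℂ (TensorProduct.map a b (matInner u v k l)) =
      ∑ t, a (u k t) * b (v t l) := by
  simp [matInner]

/-- A factorisation of the comultiplication turns convolution into a product of scalar matrices,
which is what links the Haagerup norm to submultiplicativity. -/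
theorem amp_mul (f g : CStarMatrix ι ι (DualAlg C)) {m r : ℕ} (x : Matrix (Fin m) (Fin m) C)
    (u : Matrix (Fin m) (Fin r) C) (v : Matrix (Fin r) (Fin m) C)
    (h : x.map (CoalgebraStruct.comul (R := ℂ)) = matInner u v) :
    amp (f * g) x = amp f u * amp g v := by
  ext ⟨k, i⟩ ⟨l, j⟩
  have hkl : CoalgebraStruct.comul (R := ℂ) (x k l) = matInner u v k l :=
    congrFun (congrFun h k) l
  rw [amp_apply, CStarMatrix.mul_apply, map_sum, LinearMap.sum_apply, Matrix.mul_apply,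
    Fintype.sum_prod_type]
  simp only [DualAlg.toDual_mul, hkl, mul'_map_matInner, amp_apply]
  exact Finset.sum_comm

variable (C) in
/-- Every matrix over `C ⊗ C` is a matrix inner product. -/
theorem exists_eq_matInner [FiniteDimensional ℂ C] {n : ℕ} (w : Matrix (Fin n) (Fin n) (C ⊗[ℂ] C)) :
    ∃ (r : ℕ) (x : Matrix (Fin n) (Fin r) C) (y : Matrix (Fin r) (Fin n) C), w = matInner x y := by
  let b := Module.finBasis ℂ C
  have hw : ∀ t : C ⊗[ℂ] C, ∃ c : Fin (Module.finrank ℂ C) → C, t = ∑ p, c p ⊗ₜ[ℂ] b p := by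
    intro t
    induction t with
    | zero => exact ⟨0, by simp⟩
    | add s t hs ht =>
      obtain ⟨c, rfl⟩ := hs
      obtain ⟨d, rfl⟩ := ht
      exact ⟨c + d, by simp [TensorProduct.add_tmul, Finset.sum_add_distrib]⟩
    | tmul s t =>
      refine ⟨fun p => b.repr t p • s, ?_⟩
      conv_lhs => rw [← b.sum_repr t, TensorProduct.tmul_sum]
      simp only [TensorProduct.smul_tmul]
  choose c hc using fun i j => hw (w i j)
  let e : Fin n × Fin (Module.finrank ℂ C) ≃ Fin (n * Module.finrank ℂ C) := finProdFinEquiv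
  refine ⟨_, of fun i s => c i (e.symm s).1 (e.symm s).2,
    of fun s j => if (e.symm s).1 = j then b (e.symm s).2 else 0, ?_⟩
  ext i j
  simp only [matInner, of_apply]
  rw [e.symm.sum_comp (fun q => c i q.1 q.2 ⊗ₜ[ℂ] if q.1 = j then b q.2 else 0),
    Fintype.sum_prod_type, hc i j, Finset.sum_comm]
  simp [TensorProduct.tmul_ite]

end IsCB

section IsCB

variable {C : Type*} [AddCommGroup C] [Module ℂ C] [FiniteDimensional ℂ C] [VNCoalgebra C]
variable {ι κ : Type*} [Fintype ι] [DecidableEq ι] [Fintype κ] [DecidableEq κ]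

open DualAlg

/-- The matrix of functionals `f` has completely bounded norm at most `K`. -/
def IsCB (f : CStarMatrix ι κ (DualAlg C)) (K : ℝ) : Prop :=
  ∀ (m : ℕ) (x : Matrix (Fin m) (Fin m) C), ‖amp f x‖ ≤ K * gauge C m x

variable {f g : CStarMatrix ι κ (DualAlg C)} {K L : ℝ}

theorem IsCB.mono (hf : IsCB f K) (h : K ≤ L) : IsCB f L := fun m x =>
  (hf m x).trans (mul_le_mul_of_nonneg_right h (gauge_nonneg _ _))

theorem IsCB.add (hf : IsCB f K) (hg : IsCB g L) : IsCB (f + g) (K + L) := fun m x => by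
  rw [amp_add, add_mul]
  exact (norm_add_le _ _).trans (add_le_add (hf m x) (hg m x))

theorem IsCB.smul (z : ℂ) (hf : IsCB f K) : IsCB (z • f) (‖z‖ * K) := fun m x => by
  rw [amp_smul, norm_smul, mul_assoc]
  exact mul_le_mul_of_nonneg_left (hf m x) (norm_nonneg _)

theorem isCB_zero : IsCB (0 : CStarMatrix ι κ (DualAlg C)) 0 := fun m x => by
  rw [show amp (0 : CStarMatrix ι κ (DualAlg C)) x = 0 from by ext; simp [amp_apply]]
  simp

theorem IsCB.submatrix {ι' κ' : Type*} [Fintype ι'] [DecidableEq ι'] [Fintype κ'] [DecidableEq κ']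
    (hf : IsCB f K) {s : ι' → ι} {t : κ' → κ} (hs : Function.Injective s)
    (ht : Function.Injective t) :
    IsCB (CStarMatrix.ofMatrix ((CStarMatrix.ofMatrix.symm f).submatrix s t)) K := fun m x => by
  refine le_trans ?_ (hf m x)
  exact norm_submatrix_le (amp f x) (f := Prod.map id s) (g := Prod.map id t)
    (Function.injective_id.prodMap hs) (Function.injective_id.prodMap ht)

theorem IsCB.norm_amp_le_rectNorm (hf : IsCB f K) {m r : ℕ} (u : Matrix (Fin m) (Fin r) C) :
    ‖amp f u‖ ≤ K * rectNorm u := by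
  refine le_trans ?_ (hf _ (pad u))
  have e : amp f u = (amp f (pad u)).submatrix
      (Prod.map (Fin.castLE (le_max_left m r)) id) (Prod.map (Fin.castLE (le_max_right m r)) id) := by
    ext ⟨k, i⟩ ⟨l, j⟩
    simp [amp_apply, pad]
  rw [e]
  exact norm_submatrix_le _ ((Fin.castLE_injective _).prodMap Function.injective_id)
    ((Fin.castLE_injective _).prodMap Function.injective_id)

theorem rectNorm_nonneg {m r : ℕ} (u : Matrix (Fin m) (Fin r) C) : 0 ≤ rectNorm u :=
  gauge_nonneg _ _

theorem IsCB.mul {f g : CStarMatrix ι ι (DualAlg C)} (hf : IsCB f K) (hg : IsCB g L) (hK : 0 ≤ K)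
    (hL : 0 ≤ L) : IsCB (f * g) (K * L) := fun m x => by
  refine le_of_forall_pos_le_add fun ε hε => ?_
  have hn := VNCoalgebra.comul_cc (C := C) m x
  unfold haagerupGauge at hn
  -- The infimum of an empty set of reals is `0`, so a factorisation must be exhibited before a
  -- near-optimal one can be extracted. The slack is divided by `K * L + 1` to allow `K * L = 0`.
  obtain ⟨r₀, u₀, v₀, h₀⟩ := exists_eq_matInner C (x.map (CoalgebraStruct.comul (R := ℂ)))
  have hδ : 0 < ε / (K * L + 1) := by positivity
  have hne : {c : ℝ | ∃ (r : ℕ) (u : Matrix (Fin m) (Fin r) C) (v : Matrix (Fin r) (Fin m) C),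
      x.map (CoalgebraStruct.comul (R := ℂ)) = matInner u v ∧
        c = rectNorm u * rectNorm v}.Nonempty := ⟨_, r₀, u₀, v₀, h₀, rfl⟩
  obtain ⟨c, ⟨r, u, v, h, rfl⟩, hc⟩ := exists_lt_of_csInf_lt hne (lt_of_le_of_lt hn (lt_add_of_pos_right _ hδ))
  rw [amp_mul f g x u v h]
  have hu := rectNorm_nonneg u
  have hv := rectNorm_nonneg v
  calc _ ≤ ‖amp f u‖ * ‖amp g v‖ := l2_opNorm_mul _ _
    _ ≤ (K * rectNorm u) * (L * rectNorm v) := by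
      gcongr
      · exact hf.norm_amp_le_rectNorm u
      · exact hg.norm_amp_le_rectNorm v
    _ = K * L * (rectNorm u * rectNorm v) := by ring
    _ ≤ K * L * (gauge C m x + ε / (K * L + 1)) := by gcongr
    _ = K * L * gauge C m x + (K * L) * (ε / (K * L + 1)) := by ring
    _ ≤ K * L * gauge C m x + ε := by
      gcongr
      rw [mul_div_assoc', div_le_iff₀ (by positivity)]
      nlinarith [mul_nonneg hK hL]

/-- The transpose in the norm of `C_o` is exactly the one produced by the conjugate transpose of the
amplified scalar matrix. -/
theorem IsCB.star {f : CStarMatrix ι ι (DualAlg C)} (hf : IsCB f K) (hK : 0 ≤ K) :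
    IsCB (star f) K :=
  fun m x => by
  have hj := VNCoalgebra.coinv_cc (C := C) m xᵀ
  have e : amp (Star.star f) x =
      (amp f (xᵀ.map (CoInvolution.coinv : C →ₛₗ[starRingEnd ℂ] C)))ᴴ := by
    ext ⟨k, i⟩ ⟨l, j⟩
    simp only [amp_apply, CStarMatrix.star_apply, toDual_star, conjTranspose_apply, map_apply,
      transpose_apply]
  rw [e, l2_opNorm_conjTranspose]
  exact (hf m _).trans (mul_le_mul_of_nonneg_left hj hK)

theorem isCB_const [Unique ι] (a : DualAlg C) (hK : 0 ≤ K)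
    (ha : ∀ c, ‖toDual a c‖ ≤ K * norm₁ c) :
    IsCB (CStarMatrix.ofMatrix (of fun _ _ => a : Matrix ι ι (DualAlg C))) K := fun m x => by
  refine le_trans (le_of_eq ?_) (norm_map_functional_le (toDual a) hK ha x)
  rw [← norm_submatrix_equiv (x.map (toDual a)) (Equiv.prodUnique (Fin m) ι)
    (Equiv.prodUnique (Fin m) ι)]
  rfl

theorem isCB_of_tendsto {F : ℕ → CStarMatrix ι κ (DualAlg C)} {B : ℕ → ℝ}
    (hF : ∀ k, IsCB (F k) (B k))
    (h : ∀ i j c, Filter.Tendsto (fun k => toDual (F k i j) c) Filter.atTop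
      (nhds (toDual (f i j) c)))
    (hB : Filter.Tendsto B Filter.atTop (nhds K)) : IsCB f K := fun m x => by
  have h1 : Filter.Tendsto (fun k => amp (F k) x) Filter.atTop (nhds (amp f x)) :=
    tendsto_pi_nhds.2 fun p => tendsto_pi_nhds.2 fun q => h _ _ _
  exact le_of_tendsto_of_tendsto' h1.norm (hB.mul_const _) fun k => hF k m x

end IsCB

/-! ### The convolution algebra as a C⋆-algebra -/

/-- The normed space underlying the first matrix level of an operator space. -/
def LevelOne (X : Type*) : Type _ := X

namespace LevelOne

variable {X : Type*} [AddCommGroup X] [Module ℂ X]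

instance : AddCommGroup (LevelOne X) := inferInstanceAs (AddCommGroup X)
instance : Module ℂ (LevelOne X) := inferInstanceAs (Module ℂ X)
instance [FiniteDimensional ℂ X] : FiniteDimensional ℂ (LevelOne X) :=
  inferInstanceAs (FiniteDimensional ℂ X)

variable (X) in
/-- The identity map. -/
def equiv : X ≃ₗ[ℂ] LevelOne X := LinearEquiv.refl ℂ X

variable [OperatorSpace X]

instance : Norm (LevelOne X) := ⟨fun c => norm₁ (X := X) c⟩

theorem core : NormedSpace.Core ℂ (LevelOne X) where
  norm_nonneg c := norm₁_nonneg (X := X) c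
  norm_smul z c := norm₁_smul (X := X) z c
  norm_triangle c d := norm₁_add_le (X := X) c d
  norm_eq_zero_iff c := by
    refine ⟨fun h => norm₁_eq_zero (X := X) h, fun h => ?_⟩
    rw [h]
    exact gauge_zero (X := X) 1

instance : NormedAddCommGroup (LevelOne X) := .ofCore core
instance : NormedSpace ℂ (LevelOne X) := .ofCore core

end LevelOne

namespace DualAlg

variable {C : Type*} [AddCommGroup C] [Module ℂ C] [FiniteDimensional ℂ C] [VNCoalgebra C]

/-- A functional as a continuous functional on the first matrix level. -/
def toCLM : DualAlg C ≃ₗ[ℂ] (LevelOne C →L[ℂ] ℂ) :=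
  (toDual.trans (LinearEquiv.arrowCongr (LevelOne.equiv C) (LinearEquiv.refl ℂ ℂ))).trans
    LinearMap.toContinuousLinearMap

instance : NormedAddCommGroup (DualAlg C) :=
  NormedAddCommGroup.induced (DualAlg C) (LevelOne C →L[ℂ] ℂ) toCLM.toLinearMap toCLM.injective

theorem norm_eq (a : DualAlg C) : ‖a‖ = ‖toCLM a‖ := rfl

theorem norm_toDual_le (a : DualAlg C) (c : C) : ‖toDual a c‖ ≤ ‖a‖ * norm₁ c :=
  (toCLM a).le_opNorm (LevelOne.equiv C c)

theorem norm_le {a : DualAlg C} {K : ℝ} (hK : 0 ≤ K) (h : ∀ c, ‖toDual a c‖ ≤ K * norm₁ c) :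
    ‖a‖ ≤ K :=
  (toCLM a).opNorm_le_bound hK h

theorem isCB_const_norm {ι : Type*} [Fintype ι] [DecidableEq ι] [Unique ι] (a : DualAlg C) :
    IsCB (CStarMatrix.ofMatrix (of fun _ _ => a : Matrix ι ι (DualAlg C))) ‖a‖ :=
  isCB_const a (norm_nonneg a) (norm_toDual_le a)

theorem norm_entry_le_of_isCB {ι κ : Type*} [Fintype ι] [DecidableEq ι] [Fintype κ]
    [DecidableEq κ] {f : CStarMatrix ι κ (DualAlg C)} {K : ℝ} (hf : IsCB f K) (hK : 0 ≤ K)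
    (i : ι) (j : κ) : ‖f i j‖ ≤ K :=
  norm_le hK fun c => (norm_entry_le (amp f (of fun _ _ => c : Matrix (Fin 1) (Fin 1) C))
    (0, i) (0, j)).trans (hf 1 _)

instance : NormedRing (DualAlg C) where
  __ := (inferInstance : Ring (DualAlg C))
  __ := (inferInstance : NormedAddCommGroup (DualAlg C))
  norm_mul_le a b := by
    have h := (isCB_const_norm (ι := Unit) a).mul (isCB_const_norm b) (norm_nonneg a)
      (norm_nonneg b)
    have h2 := norm_entry_le_of_isCB h (by positivity) () ()
    rw [CStarMatrix.mul_apply] at h2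
    simpa using h2

instance : NormedAlgebra ℂ (DualAlg C) where
  norm_smul_le z a := by
    rw [norm_eq, norm_eq, map_smul]
    exact (norm_smul z (toCLM a)).le

instance : FiniteDimensional ℂ (DualAlg C) :=
  Module.Finite.equiv (toDual (C := C)).symm

instance : CompleteSpace (DualAlg C) := FiniteDimensional.complete ℂ (DualAlg C)

/-- A norm-one functional is completely contractive, and a scalar matrix `y` lifts to `y ⊗ c / e(c)`
with `c` almost norming `e`. -/
theorem isCQ_of_norm_eq_one {e : DualAlg C} (he : ‖e‖ = 1) :
    IsCQ (gauge C) scalarGauge (toDual e) := by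
  intro n
  ext y
  simp only [Set.mem_image, Set.mem_ofPred_eq, scalarGauge, opNorm_eq]
  constructor
  · rintro ⟨x, hx, rfl⟩
    have h := norm_map_functional_le (toDual e) zero_le_one
      (fun c => (norm_toDual_le e c).trans (by rw [he])) x
    linarith
  · intro hy
    -- If `c` satisfies `s ‖c‖ < |e(c)|`, the lift has norm at most `‖y‖ / s`, which is below `1`.
    obtain ⟨s, hs1, hs2⟩ := exists_between hy
    have hs0 : 0 < s := (norm_nonneg _).trans_lt hs1
    obtain ⟨c, hc⟩ : ∃ c : C, s * norm₁ c < ‖toDual e c‖ := by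
      by_contra! h
      have := norm_le hs0.le h
      linarith
    have hc0 : 0 < ‖toDual e c‖ := (mul_nonneg hs0.le (norm₁_nonneg c)).trans_lt hc
    have hne : toDual e c ≠ 0 := norm_pos_iff.1 hc0
    refine ⟨of fun i j => y i j • ((toDual e c)⁻¹ • c), ?_, ?_⟩
    · refine (gauge_smul_const_le y _).trans_lt ?_
      rw [norm₁_smul, norm_inv]
      have : ‖toDual e c‖⁻¹ * norm₁ c < s⁻¹ := by
        rw [inv_mul_lt_iff₀ hc0, ← div_eq_mul_inv, lt_div_iff₀ hs0]
        linarith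
      calc _ ≤ ‖y‖ * s⁻¹ := by gcongr
        _ < 1 := by rw [← div_eq_mul_inv, div_lt_one hs0]; exact hs1
    · ext i j
      simp [hne]

/-- Already at level one, the quotient property makes `star e * e` take every value `s < 1` on the
open unit ball. -/
theorem one_le_norm_star_mul_self {e : DualAlg C} (he : ‖e‖ = 1) : 1 ≤ ‖star e * e‖ := by
  have h := VNCoalgebra.coSquare_cq _ (isCQ_of_norm_eq_one he) 1
  rw [← toDual_star_mul_self] at h
  refine le_of_forall_lt fun r hr => ?_
  rcases lt_or_ge r 0 with h0 | h0
  · exact h0.trans_le (norm_nonneg _)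
  obtain ⟨s, hs1, hs2⟩ := exists_between hr
  have hy : (diagonal fun _ => (s : ℂ)) ∈ {y : Matrix (Fin 1) (Fin 1) ℂ | scalarGauge 1 y < 1} := by
    simp only [Set.mem_ofPred_eq, scalarGauge, opNorm_eq, l2_opNorm_diagonal]
    simp only [pi_norm_const, Complex.norm_real, Real.norm_eq_abs]
    rwa [abs_of_nonneg (h0.trans hs1.le)]
  rw [← h] at hy
  obtain ⟨x, hx, hxs⟩ := hy
  have hx' : norm₁ (x 0 0) < 1 := by
    have : gauge C 1 xᵀ < 1 := hx
    rwa [gauge_one] at this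
  have hv : toDual (star e * e) (x 0 0) = s := by
    have := congrFun (congrFun hxs 0) 0
    simpa using this
  have h2 := norm_toDual_le (star e * e) (x 0 0)
  rw [hv, Complex.norm_real, Real.norm_eq_abs, abs_of_nonneg (h0.trans hs1.le)] at h2
  nlinarith [norm_nonneg (star e * e), norm₁_nonneg (x 0 0)]

instance : CStarRing (DualAlg C) where
  norm_mul_self_le x := by
    rcases eq_or_ne x 0 with rfl | hx
    · simp
    have hx0 : 0 < ‖x‖ := norm_pos_iff.2 hx
    have hn : ‖((‖x‖⁻¹ : ℝ) : ℂ)‖ = ‖x‖⁻¹ := by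
      rw [Complex.norm_real, norm_inv, norm_norm]
    have h := one_le_norm_star_mul_self (e := ((‖x‖⁻¹ : ℝ) : ℂ) • x) (by
      rw [norm_smul, hn]
      exact inv_mul_cancel₀ hx0.ne')
    rw [star_smul, smul_mul_smul_comm, norm_smul, norm_mul, norm_star, hn] at h
    rw [← mul_inv, le_inv_mul_iff₀ (by positivity)] at h
    linarith

instance : CStarAlgebra (DualAlg C) where

instance : PartialOrder (DualAlg C) := CStarAlgebra.spectralOrder _
instance : StarOrderedRing (DualAlg C) := CStarAlgebra.spectralOrderedRing _

end DualAlg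

open DualAlg

/-! ### The completely bounded norm is the C⋆-norm -/

section Projection

variable {m ι : Type*} [Fintype m] [DecidableEq m] [Fintype ι] [DecidableEq ι]

/-- The representation `(x, y) ↦ x ⊗ (1 - p) + y ⊗ p` defined by a projection `p`. -/
def projectionRep (P : Matrix ι ι ℂ) (hP : P * P = P) (hP' : Pᴴ = P) :
    (Matrix m m ℂ × Matrix m m ℂ) →⋆ₙₐ[ℂ] Matrix (m × ι) (m × ι) ℂ where
  toFun z := z.1 ⊗ₖ (1 - P) + z.2 ⊗ₖ P
  map_smul' c z := by
    simp [Matrix.smul_kronecker, smul_add]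
  map_zero' := by simp
  map_add' z w := by
    simp only [Prod.fst_add, Prod.snd_add, Matrix.add_kronecker]
    abel
  map_mul' z w := by
    have h1 : (1 - P) * (1 - P) = 1 - P := by simp [sub_mul, mul_sub, hP]
    have h2 : (1 - P) * P = 0 := by simp [sub_mul, hP]
    have h3 : P * (1 - P) = 0 := by simp [mul_sub, hP]
    simp only [Prod.fst_mul, Prod.snd_mul, add_mul, mul_add, ← Matrix.mul_kronecker_mul, h1, h2, h3,
      hP, Matrix.kronecker_zero, add_zero, zero_add]
  map_star' z := by
    simp only [Prod.fst_star, Prod.snd_star, star_eq_conjTranspose, conjTranspose_add,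
      conjTranspose_kronecker, conjTranspose_sub, conjTranspose_one, hP']

/-- A ⋆-homomorphism is contractive, and the product C⋆-algebra carries the maximum norm. -/
theorem norm_projectionRep_le (P : Matrix ι ι ℂ) (hP : P * P = P) (hP' : Pᴴ = P)
    (x y : Matrix m m ℂ) : ‖x ⊗ₖ (1 - P) + y ⊗ₖ P‖ ≤ max ‖x‖ ‖y‖ :=
  NonUnitalStarAlgHom.norm_apply_le (projectionRep P hP hP') (x, y)

end Projection

variable {C : Type*} [AddCommGroup C] [Module ℂ C] [FiniteDimensional ℂ C] [VNCoalgebra C]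
variable {ι κ : Type*} [Fintype ι] [DecidableEq ι] [Fintype κ] [DecidableEq κ]

theorem amp_one {m : ℕ} (x : Matrix (Fin m) (Fin m) C) :
    amp (1 : CStarMatrix ι ι (DualAlg C)) x = x.map (toDual (1 : DualAlg C)) ⊗ₖ 1 := by
  ext ⟨k, i⟩ ⟨l, j⟩
  rw [amp_apply, CStarMatrix.one_apply, kroneckerMap_apply, Matrix.one_apply]
  split_ifs <;> simp

theorem norm_map_one_le {m : ℕ} (x : Matrix (Fin m) (Fin m) C) :
    ‖x.map (toDual (1 : DualAlg C))‖ ≤ gauge C m x :=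
  VNCoalgebra.counit_cc (C := C) m x

theorem isCB_one : IsCB (1 : CStarMatrix ι ι (DualAlg C)) 1 := fun m x => by
  rw [amp_one, one_mul]
  have h := norm_projectionRep_le (1 : Matrix ι ι ℂ) (one_mul 1) conjTranspose_one 0
    (x.map (toDual (1 : DualAlg C)))
  rw [Matrix.zero_kronecker, zero_add, norm_zero, max_eq_right (norm_nonneg _)] at h
  exact h.trans (norm_map_one_le x)

theorem IsCB.pow {f : CStarMatrix ι ι (DualAlg C)} {K : ℝ} (hf : IsCB f K) (hK : 0 ≤ K) (n : ℕ) :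
    IsCB (f ^ n) (K ^ n) := by
  induction n with
  | zero => simpa using isCB_one
  | succ n ih =>
    rw [pow_succ, pow_succ]
    exact ih.mul hf (pow_nonneg hK n) hK

variable (C ι) in
-- A crude entrywise comparison. Only the independence of `c` from `f` and `K` matters, since
-- passing to powers removes the constant.
theorem exists_norm_le_mul_of_isCB : ∃ c : ℝ, 0 ≤ c ∧
    ∀ (f : CStarMatrix ι ι (DualAlg C)) (K : ℝ), 0 ≤ K → IsCB f K → ‖f‖ ≤ c * K := by
  let T : (ι → ι → DualAlg C) →L[ℂ] CStarMatrix ι ι (DualAlg C) :=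
    { toFun := fun f => CStarMatrix.ofMatrix f
      map_add' := fun _ _ => rfl
      map_smul' := fun _ _ => rfl
      cont := continuous_id }
  refine ⟨‖T‖, norm_nonneg _, fun f K hK hf => ?_⟩
  refine (T.le_opNorm fun i j => f i j).trans ?_
  gcongr
  exact (pi_norm_le_iff_of_nonneg hK).2 fun i => (pi_norm_le_iff_of_nonneg hK).2 fun j =>
    norm_entry_le_of_isCB hf hK i j

theorem norm_le_of_isCB {f : CStarMatrix ι ι (DualAlg C)} {K : ℝ} (hK : 0 ≤ K) (hf : IsCB f K) :
    ‖f‖ ≤ K := by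
  obtain ⟨c, hc, H⟩ := exists_norm_le_mul_of_isCB C ι
  have hsa : IsSelfAdjoint (star f * f) := IsSelfAdjoint.star_mul_self f
  -- The C⋆-norm is exactly multiplicative on these powers of a self-adjoint element, the cb bound
  -- is submultiplicative, and `c` does not grow with `k`.
  have h1 : ∀ k : ℕ, ‖star f * f‖ ^ 2 ^ k ≤ c * (K * K) ^ 2 ^ k := fun k => by
    have e := congrArg NNReal.toReal (hsa.nnnorm_pow_two_pow k)
    simp only [coe_nnnorm, NNReal.coe_pow] at e
    rw [← e]
    exact H _ _ (by positivity) (((hf.star hK).mul hf hK hK).pow (by positivity) _)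
  rw [← abs_of_nonneg (norm_nonneg f), ← abs_of_nonneg hK, ← sq_le_sq, sq, sq,
    ← CStarRing.norm_star_mul_self]
  by_contra! hlt
  rcases eq_or_lt_of_le hK with h0 | h0
  · have := H f K hK hf
    rw [← h0, mul_zero] at this
    have hf0 : f = 0 := norm_le_zero_iff.1 this
    rw [hf0] at hlt
    simp [← h0] at hlt
  · have hKK : 0 < K * K := by positivity
    have hr : 1 < ‖star f * f‖ / (K * K) := by rwa [lt_div_iff₀ hKK, one_mul]
    have ht := (tendsto_pow_atTop_atTop_of_one_lt hr).comp
      (tendsto_pow_atTop_atTop_of_one_lt (one_lt_two (α := ℕ)))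
    obtain ⟨k, hk⟩ := (ht.eventually (Filter.eventually_gt_atTop c)).exists
    simp only [Function.comp, div_pow] at hk
    rw [lt_div_iff₀ (by positivity)] at hk
    exact absurd (h1 k) (not_le.2 hk)

/-! ### Hermitian elements for the completely bounded norm. -/

/-- A numerical hermiticity condition for the completely bounded norm. -/
def IsHermCB (f : CStarMatrix ι ι (DualAlg C)) : Prop :=
  ∃ c : ℝ, 0 ≤ c ∧ ∀ t : ℝ, IsCB (1 + ((t : ℂ) * Complex.I) • f) (1 + c * t ^ 2)

namespace IsHermCB

variable {f g : CStarMatrix ι ι (DualAlg C)}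

theorem exists_isCB (hf : IsHermCB f) : ∃ B : ℝ, 0 ≤ B ∧ IsCB f B := by
  obtain ⟨c, hc, h⟩ := hf
  have h1 := ((h 1).add (isCB_one.smul (-1))).smul (-Complex.I)
  have e : -Complex.I • (1 + ((1 : ℝ) * Complex.I) • f + (-1 : ℂ) • 1) = f := by
    rw [Complex.ofReal_one, one_mul, add_comm (1 : CStarMatrix ι ι (DualAlg C)), add_assoc,
      neg_one_smul, add_neg_cancel, add_zero, smul_smul]
    simp
  rw [e] at h1
  exact ⟨_, by positivity, h1⟩

/-- For `|t| > 1` the trivial linear bound `1 + |t| B` is already dominated by `1 + B t²`. -/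
theorem of_small {B c : ℝ} (hB : 0 ≤ B) (hc : 0 ≤ c) (hfB : IsCB f B)
    (h : ∀ t : ℝ, |t| ≤ 1 → IsCB (1 + ((t : ℂ) * Complex.I) • f) (1 + c * t ^ 2)) :
    IsHermCB f := by
  refine ⟨max c B, by positivity, fun t => ?_⟩
  rcases le_or_gt |t| 1 with ht | ht
  · refine (h t ht).mono ?_
    gcongr
    exact le_max_left _ _
  · refine (isCB_one.add (hfB.smul ((t : ℂ) * Complex.I))).mono ?_
    have : ‖(t : ℂ) * Complex.I‖ = |t| := by simp
    rw [this, ← sq_abs t]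
    have : |t| ≤ |t| ^ 2 := by nlinarith
    calc 1 + |t| * B ≤ 1 + |t| ^ 2 * B := by gcongr
      _ = 1 + B * |t| ^ 2 := by ring
      _ ≤ _ := by gcongr; exact le_max_right _ _

theorem add (hf : IsHermCB f) (hg : IsHermCB g) : IsHermCB (f + g) := by
  obtain ⟨A, hA, hfA⟩ := hf.exists_isCB
  obtain ⟨B, hB, hgB⟩ := hg.exists_isCB
  obtain ⟨c, hc, h1⟩ := hf
  obtain ⟨d, hd, h2⟩ := hg
  -- The identity used is `1 + it(f + g) = (1 + itf)(1 + itg) + t² fg`. Its bound is `(1 + ct²)(1 +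
  -- dt²) + ABt²`, and `t⁴ ≤ t²` yields the constant.
  refine of_small (B := A + B) (c := c + d + c * d + A * B) (by positivity) (by positivity)
    (hfA.add hgB) fun t ht => ?_
  have h3 := ((h1 t).mul (h2 t) (by positivity) (by positivity)).add
    ((hfA.mul hgB hA hB).smul ((t : ℂ) ^ 2))
  have e : (1 + ((t : ℂ) * Complex.I) • f) * (1 + ((t : ℂ) * Complex.I) • g) +
      ((t : ℂ) ^ 2) • (f * g) = 1 + ((t : ℂ) * Complex.I) • (f + g) := by
    have hI : ((t : ℂ) * Complex.I) * ((t : ℂ) * Complex.I) = -(t : ℂ) ^ 2 := by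
      linear_combination (t : ℂ) ^ 2 * Complex.I_mul_I
    rw [mul_add, mul_one, add_mul, one_mul, smul_mul_smul_comm, hI, neg_smul, smul_add]
    abel
  rw [e] at h3
  refine h3.mono ?_
  have : ‖(t : ℂ) ^ 2‖ = t ^ 2 := by simp
  rw [this]
  have ht2 : t ^ 2 ≤ 1 := by rw [← sq_abs]; nlinarith [abs_nonneg t]
  have ht4 : c * d * (t ^ 2 * t ^ 2) ≤ c * d * (t ^ 2 * 1) := by gcongr
  nlinarith

theorem smul (r : ℝ) (hf : IsHermCB f) : IsHermCB ((r : ℂ) • f) := by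
  obtain ⟨c, hc, h⟩ := hf
  refine ⟨c * r ^ 2, by positivity, fun t => ?_⟩
  have h1 := h (t * r)
  rw [smul_smul]
  convert h1 using 1
  · push_cast
    congr 2
    ring
  · ring

theorem zero : IsHermCB (0 : CStarMatrix ι ι (DualAlg C)) :=
  ⟨0, le_rfl, fun t => by simpa using isCB_one⟩

theorem sub (hf : IsHermCB f) (hg : IsHermCB g) : IsHermCB (f - g) := by
  have := hf.add (hg.smul (-1))
  simpa [sub_eq_add_neg] using this

theorem sum {α : Type*} (s : Finset α) (F : α → CStarMatrix ι ι (DualAlg C))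
    (h : ∀ a ∈ s, IsHermCB (F a)) : IsHermCB (∑ a ∈ s, F a) := by
  classical
  induction s using Finset.induction_on with
  | empty => simpa using zero
  | insert a s ha ih =>
    rw [Finset.sum_insert ha]
    exact (h a (Finset.mem_insert_self _ _)).add
      (ih fun b hb => h b (Finset.mem_insert_of_mem hb))

end IsHermCB

/-- For `x = 1 + ith` the linear terms of `star x * x` cancel, leaving `1 + t² h²`. -/
theorem norm_one_add_I_smul_sq_le {M : Type*} [CStarAlgebra M] {h : M} (hh : IsSelfAdjoint h)
    (t : ℝ) :
    ‖1 + ((t : ℂ) * Complex.I) • h‖ ^ 2 ≤ 1 + t ^ 2 * ‖h‖ ^ 2 := by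
  have h1 : ‖(1 : M)‖ ≤ 1 := by
    rcases subsingleton_or_nontrivial M with hM | hM
    · rw [Subsingleton.elim (1 : M) 0]; simp
    · exact CStarRing.norm_one.le
  have e : star (1 + ((t : ℂ) * Complex.I) • h) * (1 + ((t : ℂ) * Complex.I) • h) =
      1 + ((t : ℂ) ^ 2) • (h * h) := by
    have hI : star ((t : ℂ) * Complex.I) = -((t : ℂ) * Complex.I) := by simp
    have hI2 : ((t : ℂ) * Complex.I) * ((t : ℂ) * Complex.I) = -(t : ℂ) ^ 2 := by
      linear_combination (t : ℂ) ^ 2 * Complex.I_mul_I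
    rw [star_add, star_one, star_smul, hh.star_eq, hI, mul_add, mul_one, add_mul, one_mul,
      smul_mul_smul_comm, neg_mul, hI2, neg_neg, neg_smul]
    abel
  rw [sq ‖1 + _‖, ← CStarRing.norm_star_mul_self, e]
  refine (norm_add_le _ _).trans (add_le_add h1 ?_)
  rw [norm_smul, hh.norm_mul_self]
  simp

theorem norm_one_add_I_smul_le {M : Type*} [CStarAlgebra M] {h : M} (hh : IsSelfAdjoint h)
    (t : ℝ) : ‖1 + ((t : ℂ) * Complex.I) • h‖ ≤ 1 + ‖h‖ ^ 2 * t ^ 2 := by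
  have h1 := norm_one_add_I_smul_sq_le hh t
  have h2 : 0 ≤ ‖h‖ ^ 2 * t ^ 2 := by positivity
  nlinarith [norm_nonneg (1 + ((t : ℂ) * Complex.I) • h)]

/-- The elementary tensor of a scalar matrix and a functional. -/
def scalarTensor (P : Matrix ι ι ℂ) (a : DualAlg C) : CStarMatrix ι ι (DualAlg C) :=
  CStarMatrix.ofMatrix (of fun i j => P i j • a)

theorem scalarTensor_apply (P : Matrix ι ι ℂ) (a : DualAlg C) (i j : ι) :
    scalarTensor P a i j = P i j • a := rfl

/-- The element `1 + it (P ⊗ h)` acts as the unit on the range of `1 - P` and as `1 + ith` on the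
range of `P`, so its cb bound is the maximum of two bounds for single functionals. -/
theorem isHermCB_projection {P : Matrix ι ι ℂ} (hP : P * P = P) (hP' : Pᴴ = P) {h : DualAlg C}
    (hh : IsSelfAdjoint h) : IsHermCB (scalarTensor P h) := by
  refine ⟨‖h‖ ^ 2, by positivity, fun t m x => ?_⟩
  have e : amp (1 + ((t : ℂ) * Complex.I) • scalarTensor P h) x =
      x.map (toDual (1 : DualAlg C)) ⊗ₖ (1 - P) +
        x.map (toDual (1 + ((t : ℂ) * Complex.I) • h)) ⊗ₖ P := by
    rw [amp_add, amp_one, amp_smul]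
    ext ⟨k, i⟩ ⟨l, j⟩
    simp only [Matrix.add_apply, Matrix.smul_apply, kroneckerMap_apply, map_apply, amp_apply, scalarTensor_apply,
      map_add, map_smul, LinearMap.add_apply, LinearMap.smul_apply, smul_eq_mul,
      Matrix.sub_apply]
    ring
  rw [e]
  refine (norm_projectionRep_le P hP hP' _ _).trans (max_le ?_ ?_)
  · refine (norm_map_one_le x).trans ?_
    have : 0 ≤ ‖h‖ ^ 2 * t ^ 2 := by positivity
    nlinarith [gauge_nonneg m x]
  · refine (norm_map_functional_le _ (norm_nonneg _) (norm_toDual_le _) x).trans ?_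
    gcongr
    · exact gauge_nonneg m x
    · exact norm_one_add_I_smul_le hh t

open scoped ComplexOrder in
theorem isHermCB_vecMulVec (ξ : ι → ℂ) {h : DualAlg C} (hh : IsSelfAdjoint h) :
    IsHermCB (scalarTensor (vecMulVec ξ (star ξ)) h) := by
  rcases eq_or_ne ξ 0 with rfl | hξ
  · convert IsHermCB.zero (C := C) (ι := ι) using 1
    ext i j
    simp [scalarTensor_apply]
  obtain ⟨r, hr⟩ : ∃ r : ℝ, star ξ ⬝ᵥ ξ = (r : ℂ) :=
    ⟨∑ i, Complex.normSq (ξ i), by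
      simp [dotProduct, Complex.normSq_eq_conj_mul_self]⟩
  have hr0 : (r : ℂ) ≠ 0 := by
    rw [← hr]
    exact fun h => hξ (dotProduct_star_self_eq_zero.1 h)
  have hV : vecMulVec ξ (star ξ) * vecMulVec ξ (star ξ) = (r : ℂ) • vecMulVec ξ (star ξ) := by
    rw [vecMulVec_mul_vecMulVec, hr]
    ext i j
    simp [vecMulVec_apply]
    ring
  have hV' : (vecMulVec ξ (star ξ))ᴴ = vecMulVec ξ (star ξ) := by
    ext i j
    simp [vecMulVec_apply, mul_comm]
  have h1 := (isHermCB_projection (P := (r : ℂ)⁻¹ • vecMulVec ξ (star ξ)) (by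
      rw [smul_mul_smul_comm, hV, smul_smul, mul_assoc, inv_mul_cancel₀ hr0, mul_one]) (by
      rw [conjTranspose_smul, hV']; simp) hh).smul r
  convert h1 using 1
  ext i j
  simp [scalarTensor_apply, smul_smul, hr0]

theorem isHermCB_polarization (ξ η : ι → ℂ) {h : DualAlg C} (hh : IsSelfAdjoint h) :
    IsHermCB (scalarTensor (vecMulVec ξ (star η) + vecMulVec η (star ξ)) h) := by
  have := ((isHermCB_vecMulVec (ξ + η) hh).sub (isHermCB_vecMulVec ξ hh)).sub
    (isHermCB_vecMulVec η hh)
  convert this using 1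
  ext i j
  simp only [CStarMatrix.sub_apply, scalarTensor_apply, Matrix.add_apply, vecMulVec_apply, Pi.add_apply,
    Pi.star_apply, star_add, ← sub_smul]
  congr 1
  ring

/-- A self-adjoint matrix is half the sum over `i, j` of `e_ij ⊗ f_ij` plus its adjoint, and each
summand comes from polarised rank-one tensors. -/
theorem isHermCB_of_isSelfAdjoint {f : CStarMatrix ι ι (DualAlg C)} (hf : IsSelfAdjoint f) :
    IsHermCB f := by
  have key : ∀ (i j : ι) (a : DualAlg C), IsHermCB (scalarTensor (single i j (1 : ℂ)) a +
      scalarTensor (single j i (1 : ℂ)) (star a)) := fun i j a => by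
    -- The factor `-I` makes the second term `(I e_ij - I e_ji) ⊗ Im a`, which completes `Re a` to
    -- `a` at `e_ij` and to `star a` at `e_ji`.
    have h1 := (isHermCB_polarization (Pi.single i 1) (Pi.single j 1)
      (realPart a).2).add (isHermCB_polarization (Pi.single i 1)
        ((-Complex.I) • Pi.single j 1) (imaginaryPart a).2)
    convert h1 using 1
    have e1 : star (Pi.single i (1 : ℂ) : ι → ℂ) = Pi.single i 1 := by
      rw [← Pi.single_star, star_one]
    have e2 : star (Pi.single j (1 : ℂ) : ι → ℂ) = Pi.single j 1 := by
      rw [← Pi.single_star, star_one]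
    ext k l
    have ha : a = (realPart a : DualAlg C) + Complex.I • (imaginaryPart a : DualAlg C) :=
      (realPart_add_I_smul_imaginaryPart a).symm
    have ha' : star a = (realPart a : DualAlg C) - Complex.I • (imaginaryPart a : DualAlg C) := by
      conv_lhs => rw [ha]
      rw [star_add, star_smul, (realPart a).2.star_eq, (imaginaryPart a).2.star_eq]
      simp [sub_eq_add_neg]
    rw [star_smul, e1, e2, single_eq_single_vecMulVec_single, single_eq_single_vecMulVec_single]
    simp only [CStarMatrix.add_apply, scalarTensor_apply, Matrix.add_apply, vecMulVec_apply, Pi.smul_apply,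
      smul_eq_mul]
    conv_lhs => rw [ha', ha]
    simp
    module
  have h2 := (IsHermCB.sum Finset.univ _ fun i _ => IsHermCB.sum Finset.univ _ fun j _ =>
    key i j (f i j)).smul (1 / 2)
  convert h2 using 1
  have hs : ∀ (F : ι → CStarMatrix ι ι (DualAlg C)) (k l : ι),
      (∑ i, F i) k l = ∑ i, F i k l := fun F k l => Matrix.sum_apply k l Finset.univ F
  ext k l
  have hkl : star (f l k) = f k l := by
    rw [← CStarMatrix.star_apply, hf.star_eq]
  rw [CStarMatrix.smul_apply, hs]
  simp only [hs, CStarMatrix.add_apply, scalarTensor_apply, single_apply, Finset.sum_add_distrib]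
  simp only [ite_and, ite_smul, one_smul, zero_smul]
  simp only [Finset.sum_ite_irrel, Finset.sum_const_zero, Finset.sum_ite_eq', Finset.mem_univ, if_true, hkl]
  module

/-! ### Block matrices over a C⋆-algebra -/

/-- Positive elements of a C⋆-algebra are squares. -/
theorem nonneg_iff_exists_star_mul_self {B : Type*} [CStarAlgebra B] [PartialOrder B]
    [StarOrderedRing B] {a : B} : 0 ≤ a ↔ ∃ b, a = star b * b :=
  CStarAlgebra.nonneg_iff_eq_star_mul_self

/-- A self-adjoint contraction is the real part of a unitary. -/
theorem exists_unitary_add_star {B : Type*} [CStarAlgebra B] [PartialOrder B]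
    [StarOrderedRing B] {a : B} (ha : IsSelfAdjoint a) (h : ‖a‖ ≤ 1) :
    ∃ v ∈ unitary B, (1 / 2 : ℂ) • (v + star v) = a := by
  refine ⟨_, ha.self_add_I_smul_cfcSqrt_sub_sq_mem_unitary a h, ?_⟩
  have hs : star (CFC.sqrt (1 - a ^ 2)) = CFC.sqrt (1 - a ^ 2) :=
    (CFC.sqrt_nonneg (1 - a ^ 2)).isSelfAdjoint
  rw [star_add, star_smul, ha.star_eq, hs]
  simp only [RCLike.star_def, Complex.conj_I]
  module

section Block

variable {A : Type*} [CStarAlgebra A] {ι : Type*} [Fintype ι] [DecidableEq ι]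

/-- A two by two block matrix. -/
def block (a b c d : CStarMatrix ι ι A) : CStarMatrix (ι ⊕ ι) (ι ⊕ ι) A :=
  CStarMatrix.ofMatrix (fromBlocks (CStarMatrix.ofMatrix.symm a) (CStarMatrix.ofMatrix.symm b)
    (CStarMatrix.ofMatrix.symm c) (CStarMatrix.ofMatrix.symm d))

theorem block_mul (a b c d a' b' c' d' : CStarMatrix ι ι A) :
    block a b c d * block a' b' c' d' =
      block (a * a' + b * c') (a * b' + b * d') (c * a' + d * c') (c * b' + d * d') :=
  fromBlocks_multiply (CStarMatrix.ofMatrix.symm a) (CStarMatrix.ofMatrix.symm b)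
    (CStarMatrix.ofMatrix.symm c) (CStarMatrix.ofMatrix.symm d) (CStarMatrix.ofMatrix.symm a')
    (CStarMatrix.ofMatrix.symm b') (CStarMatrix.ofMatrix.symm c') (CStarMatrix.ofMatrix.symm d')

theorem block_star (a b c d : CStarMatrix ι ι A) :
    star (block a b c d) = block (star a) (star c) (star b) (star d) :=
  fromBlocks_conjTranspose (CStarMatrix.ofMatrix.symm a) (CStarMatrix.ofMatrix.symm b)
    (CStarMatrix.ofMatrix.symm c) (CStarMatrix.ofMatrix.symm d)

theorem block_one : block 1 0 0 1 = (1 : CStarMatrix (ι ⊕ ι) (ι ⊕ ι) A) :=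
  fromBlocks_one

theorem block_sub (a b c d a' b' c' d' : CStarMatrix ι ι A) :
    block a b c d - block a' b' c' d' = block (a - a') (b - b') (c - c') (d - d') := by
  ext (i | i) (j | j) <;> rfl

variable [PartialOrder A] [StarOrderedRing A]

theorem norm_le_one_iff {f : CStarMatrix ι ι A} : ‖f‖ ≤ 1 ↔ 0 ≤ 1 - star f * f := by
  rw [sub_nonneg, ← CStarAlgebra.norm_le_one_iff_of_nonneg (star f * f) (star_mul_self_nonneg f),
    CStarRing.norm_star_mul_self, ← sq, sq_le_one_iff₀ (norm_nonneg f)]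

/-- The square of this self-adjoint block matrix is the diagonal of `g * star g` and `star g * g`,
so the two complements of `1` have square roots blockwise. -/
theorem norm_block_offDiag_le_one {g : CStarMatrix ι ι A} (hg : ‖g‖ ≤ 1) :
    ‖block 0 g (star g) 0‖ ≤ 1 := by
  rw [norm_le_one_iff]
  obtain ⟨s, hs⟩ := nonneg_iff_exists_star_mul_self.1
    (norm_le_one_iff.1 ((norm_star g).trans_le hg))
  obtain ⟨t, ht⟩ := nonneg_iff_exists_star_mul_self.1 (norm_le_one_iff.1 hg)
  refine nonneg_iff_exists_star_mul_self.2 ⟨block s 0 0 t, ?_⟩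
  rw [block_star, block_star, block_mul, block_mul, ← block_one, block_sub]
  simp only [star_star, star_zero, mul_zero, zero_mul, add_zero, zero_add, sub_zero]
  rw [← hs, ← ht, star_star]

end Block

/-! ### Bounding the completely bounded norm by the C⋆-norm, from symmetries to contractions. -/

variable {C : Type*} [AddCommGroup C] [Module ℂ C] [FiniteDimensional ℂ C] [VNCoalgebra C]
variable {ι κ : Type*} [Fintype ι] [DecidableEq ι] [Fintype κ] [DecidableEq κ]

/-- The one-parameter group generated by a symmetry. -/
def symmetryGroup (W : CStarMatrix ι ι (DualAlg C)) (s : ℝ) : CStarMatrix ι ι (DualAlg C) :=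
  (Real.cos s : ℂ) • 1 + ((Real.sin s : ℂ) * Complex.I) • W

theorem symmetryGroup_add {W : CStarMatrix ι ι (DualAlg C)} (hW : W * W = 1) (s t : ℝ) :
    symmetryGroup W (s + t) = symmetryGroup W s * symmetryGroup W t := by
  simp only [symmetryGroup, mul_add, add_mul, smul_mul_smul_comm, one_mul, mul_one, hW,
    Real.cos_add, Real.sin_add]
  have : ((Real.sin s : ℂ) * Complex.I) * ((Real.sin t : ℂ) * Complex.I) =
      -((Real.sin s : ℂ) * Real.sin t) := by
    linear_combination (Real.sin s : ℂ) * Real.sin t * Complex.I_mul_I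
  rw [this]
  push_cast
  module

theorem symmetryGroup_nat_mul {W : CStarMatrix ι ι (DualAlg C)} (hW : W * W = 1) (s : ℝ) (n : ℕ) :
    symmetryGroup W (n * s) = symmetryGroup W s ^ n := by
  induction n with
  | zero => simp [symmetryGroup]
  | succ n ih => rw [pow_succ, ← ih, ← symmetryGroup_add hW]; push_cast; ring_nf

/-- The group element is `cos s • (1 + i tan s W)`. For `|s| ≤ 1` the cosine is at least `1/2`,
whence the factor `2`. -/
theorem isCB_symmetryGroup {W : CStarMatrix ι ι (DualAlg C)} {c : ℝ} (hc : 0 ≤ c)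
    (h : ∀ t : ℝ, IsCB (1 + ((t : ℂ) * Complex.I) • W) (1 + c * t ^ 2)) {s : ℝ} (hs : |s| ≤ 1) :
    IsCB (symmetryGroup W s) (1 + 2 * c * s ^ 2) := by
  have hs2 : s ^ 2 ≤ 1 := by rw [← sq_abs]; nlinarith [abs_nonneg s]
  have hcos : 1 / 2 ≤ Real.cos s := by linarith [Real.one_sub_sq_div_two_le_cos (x := s)]
  have hcos0 : (Real.cos s : ℂ) ≠ 0 := by exact_mod_cast (by linarith : Real.cos s ≠ 0)
  have hsin : Real.sin s ^ 2 ≤ s ^ 2 := sq_le_sq.2 Real.abs_sin_le_abs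
  have h1 := (h (Real.sin s / Real.cos s)).smul (Real.cos s : ℂ)
  have e : (Real.cos s : ℂ) • (1 + (((Real.sin s / Real.cos s : ℝ) : ℂ) * Complex.I) • W) =
      symmetryGroup W s := by
    rw [smul_add, smul_smul, symmetryGroup]
    congr 2
    rw [Complex.ofReal_div, ← mul_assoc, mul_div_cancel₀ _ hcos0]
  rw [e, Complex.norm_real, Real.norm_eq_abs, abs_of_nonneg (by linarith)] at h1
  refine h1.mono ?_
  have e2 : Real.cos s * (1 + c * (Real.sin s / Real.cos s) ^ 2) =
      Real.cos s + c * (Real.sin s ^ 2 / Real.cos s) := by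
    field_simp
  rw [e2]
  have h3 : Real.sin s ^ 2 / Real.cos s ≤ 2 * s ^ 2 := by
    rw [div_le_iff₀ (by linarith)]
    nlinarith [sq_nonneg s]
  nlinarith [Real.cos_le_one s, mul_le_mul_of_nonneg_left h3 hc]

/-- Up to the scalar `i`, `W` is the group element at `π/2`. Cutting that time into `N` equal steps
costs at most a factor `(1 + O(1/N²))^N`, which tends to `1`. -/
theorem isCB_symmetry {W : CStarMatrix ι ι (DualAlg C)} (hsa : IsSelfAdjoint W) (hW : W * W = 1) :
    IsCB W 1 := by
  obtain ⟨c, hc, h⟩ := isHermCB_of_isSelfAdjoint hsa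
  have key : IsCB (symmetryGroup W (Real.pi / 2)) 1 := by
    -- The sequence of matrices is constant and only the bounds vary. Using `k + 2` steps keeps each
    -- step at most `1`, because `π ≤ 4`.
    refine isCB_of_tendsto (F := fun _ => symmetryGroup W (Real.pi / 2))
      (B := fun k : ℕ => Real.exp (2 * c * (Real.pi / 2) ^ 2 / ((k : ℝ) + 2))) (fun k => ?_)
      (fun i j x => tendsto_const_nhds) ?_
    · have hk : (0 : ℝ) < (k : ℝ) + 2 := by positivity
      set s : ℝ := Real.pi / 2 / ((k : ℝ) + 2) with hs
      have hs0 : 0 ≤ s := by positivity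
      have hs1 : |s| ≤ 1 := by
        rw [abs_of_nonneg hs0, hs, div_le_one hk]
        linarith [Real.pi_le_four, (Nat.cast_nonneg k : (0 : ℝ) ≤ k)]
      have h1 := (isCB_symmetryGroup hc h hs1).pow (by positivity) (k + 2)
      rw [← symmetryGroup_nat_mul hW] at h1
      have e : ((k + 2 : ℕ) : ℝ) * s = Real.pi / 2 := by
        rw [hs]; push_cast; field_simp
      rw [e] at h1
      refine h1.mono ?_
      calc (1 + 2 * c * s ^ 2) ^ (k + 2) ≤ Real.exp (2 * c * s ^ 2) ^ (k + 2) := by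
            gcongr
            linarith [Real.add_one_le_exp (2 * c * s ^ 2)]
        _ = Real.exp (2 * c * (Real.pi / 2) ^ 2 / ((k : ℝ) + 2)) := by
            rw [← Real.exp_nat_mul, hs]
            congr 1
            push_cast
            field_simp
    · have h1 : Filter.Tendsto (fun k : ℕ => 2 * c * (Real.pi / 2) ^ 2 / ((k : ℝ) + 2))
          Filter.atTop (nhds 0) :=
        Filter.Tendsto.const_div_atTop
          (Filter.tendsto_atTop_add_const_right _ _ tendsto_natCast_atTop_atTop) _
      simpa [Function.comp_def] using (Real.continuous_exp.tendsto 0).comp h1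
  have h2 := key.smul (-Complex.I)
  have e : -Complex.I • symmetryGroup W (Real.pi / 2) = W := by
    simp [symmetryGroup, smul_smul]
  rw [e] at h2
  simpa using h2

theorem isCB_of_isCB_block {a b c d : CStarMatrix ι ι (DualAlg C)} {K : ℝ}
    (h : IsCB (block a b c d) K) : IsCB b K :=
  h.submatrix (s := Sum.inl) (t := Sum.inr) Sum.inl_injective Sum.inr_injective

/-- A unitary is a corner of the symmetry with off-diagonal blocks `v` and `star v`. -/
theorem isCB_unitary {v : CStarMatrix ι ι (DualAlg C)} (hv : v ∈ unitary (CStarMatrix ι ι (DualAlg C))) :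
    IsCB v 1 := by
  refine isCB_of_isCB_block (a := 0) (c := star v) (d := 0) (isCB_symmetry ?_ ?_)
  · rw [IsSelfAdjoint, block_star]; simp
  · rw [block_mul, ← block_one]
    simp [Unitary.mul_star_self_of_mem hv, Unitary.star_mul_self_of_mem hv]

theorem isCB_of_isSelfAdjoint {G : CStarMatrix ι ι (DualAlg C)} (hG : IsSelfAdjoint G)
    (h : ‖G‖ ≤ 1) : IsCB G 1 := by
  obtain ⟨v, hv, rfl⟩ := exists_unitary_add_star hG h
  refine (((isCB_unitary hv).add (isCB_unitary (Unitary.star_mem hv))).smul (1 / 2 : ℂ)).mono ?_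
  norm_num

/-- The completely bounded norm of a matrix of functionals is its C⋆-norm. -/
theorem isCB_iff_norm_le {f : CStarMatrix ι ι (DualAlg C)} {K : ℝ} (hK : 0 ≤ K) :
    IsCB f K ↔ ‖f‖ ≤ K := by
  refine ⟨norm_le_of_isCB hK, fun h => ?_⟩
  rcases eq_or_ne f 0 with rfl | hf
  · exact isCB_zero.mono hK
  have hf0 : 0 < ‖f‖ := norm_pos_iff.2 hf
  have hn : ‖(‖f‖ : ℂ)‖ = ‖f‖ := by simp
  have hg : ‖((‖f‖ : ℂ)⁻¹) • f‖ ≤ 1 := by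
    rw [norm_smul, norm_inv, hn, inv_mul_cancel₀ hf0.ne']
  have h1 := isCB_of_isSelfAdjoint (G := block 0 (((‖f‖ : ℂ)⁻¹) • f) (star (((‖f‖ : ℂ)⁻¹) • f)) 0)
    (by rw [IsSelfAdjoint, block_star, star_star, star_zero])
    (norm_block_offDiag_le_one hg)
  have h2 := (isCB_of_isCB_block h1).smul (‖f‖ : ℂ)
  rw [smul_smul, mul_inv_cancel₀ (by exact_mod_cast hf0.ne'), one_smul, hn, mul_one] at h2
  exact h2.mono h

/-! ### Positive and contractive unital maps -/

section UnitalContraction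

variable {M N : Type*} [CStarAlgebra M] [PartialOrder M] [StarOrderedRing M]
  [CStarAlgebra N] [PartialOrder N] [StarOrderedRing N]

/-- Contractivity on `1 + ith` bounds `1 + t d + t² (star k * k)` by `1 + t² ‖h‖²`. Dropping the
positive term, dividing by `t > 0` and letting `t → 0` leaves `d ≤ 0`. Applied to `h` and `-h`, this
shows that `Ψ h` is self-adjoint. -/
theorem I_smul_sub_star_nonpos (Ψ : M →ₗ[ℂ] N) (h1 : Ψ 1 = 1) (hΨ : ∀ a, ‖Ψ a‖ ≤ ‖a‖) {h : M}
    (hh : IsSelfAdjoint h) : Complex.I • (Ψ h - star (Ψ h)) ≤ 0 := by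
  set k := Ψ h
  set d := Complex.I • (k - star k)
  have key : ∀ t : ℝ, 0 < t → d ≤ t • (algebraMap ℝ N (‖h‖ ^ 2)) := fun t ht => by
    set x := 1 + ((t : ℂ) * Complex.I) • k with hx
    have hxn : ‖star x * x‖ ≤ 1 + t ^ 2 * ‖h‖ ^ 2 := by
      rw [CStarRing.norm_star_mul_self, ← sq]
      refine le_trans ?_ (norm_one_add_I_smul_sq_le hh t)
      have := hΨ (1 + ((t : ℂ) * Complex.I) • h)
      rw [map_add, map_smul, h1] at this
      gcongr
    have e : star x * x = 1 + t • d + (t ^ 2) • (star k * k) := by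
      have hI : star ((t : ℂ) * Complex.I) = -((t : ℂ) * Complex.I) := by simp
      have hI2 : ((t : ℂ) * Complex.I) * ((t : ℂ) * Complex.I) = -(t : ℂ) ^ 2 := by
        linear_combination (t : ℂ) ^ 2 * Complex.I_mul_I
      have ht1 : t • d = ((t : ℂ) * Complex.I) • (k - star k) := by
        rw [← smul_smul]; rfl
      have ht2 : (t ^ 2) • (star k * k) = ((t : ℂ) ^ 2) • (star k * k) := by
        rw [← Complex.ofReal_pow]; rfl
      rw [hx, ht1, ht2, star_add, star_one, star_smul, hI, mul_add, mul_one, add_mul, one_mul,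
        smul_mul_smul_comm, neg_mul, hI2, neg_neg]
      module
    have h2 : star x * x ≤ algebraMap ℝ N (1 + t ^ 2 * ‖h‖ ^ 2) :=
      ((IsSelfAdjoint.star_mul_self x).le_algebraMap_norm_self).trans
        (algebraMap_mono N hxn)
    have h3 : 0 ≤ (t ^ 2) • (star k * k) := smul_nonneg (sq_nonneg t) (star_mul_self_nonneg k)
    rw [e, map_add, map_one, map_mul, ← Algebra.smul_def] at h2
    have h4 : t • d ≤ t ^ 2 • algebraMap ℝ N (‖h‖ ^ 2) := by
      have := (le_add_of_nonneg_right h3).trans h2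
      exact le_of_add_le_add_left this
    rw [sq, ← smul_smul] at h4
    exact (smul_le_smul_iff_of_pos_left ht).1 h4
  have hlim : Filter.Tendsto (fun t : ℝ => t • (algebraMap ℝ N (‖h‖ ^ 2)))
      (nhdsWithin 0 (Set.Ioi 0)) (nhds 0) := by
    have : Filter.Tendsto (fun t : ℝ => t • (algebraMap ℝ N (‖h‖ ^ 2))) (nhds 0)
        (nhds ((0 : ℝ) • (algebraMap ℝ N (‖h‖ ^ 2)))) :=
      (continuous_id.smul continuous_const).tendsto 0
    rw [zero_smul] at this
    exact this.mono_left nhdsWithin_le_nhds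
  exact ge_of_tendsto hlim (by filter_upwards [self_mem_nhdsWithin] with t ht using key t ht)

theorem isSelfAdjoint_map (Ψ : M →ₗ[ℂ] N) (h1 : Ψ 1 = 1) (hΨ : ∀ a, ‖Ψ a‖ ≤ ‖a‖) {h : M}
    (hh : IsSelfAdjoint h) : IsSelfAdjoint (Ψ h) := by
  have h2 := I_smul_sub_star_nonpos Ψ h1 hΨ hh
  have h3 := I_smul_sub_star_nonpos Ψ h1 hΨ hh.neg
  rw [map_neg, star_neg] at h3
  have e : Complex.I • (-Ψ h - -star (Ψ h)) = -(Complex.I • (Ψ h - star (Ψ h))) := by module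
  rw [e, Left.neg_nonpos_iff] at h3
  have h4 := smul_eq_zero.1 (le_antisymm h2 h3)
  exact (sub_eq_zero.1 (h4.resolve_left Complex.I_ne_zero)).symm

/-- A unital linear contraction between C⋆-algebras is positive. -/
theorem map_nonneg_of_contractive (Ψ : M →ₗ[ℂ] N) (h1 : Ψ 1 = 1) (hΨ : ∀ a, ‖Ψ a‖ ≤ ‖a‖) {a : M}
    (ha : 0 ≤ a) : 0 ≤ Ψ a := by
  have hsa : IsSelfAdjoint a := .of_nonneg ha
  -- Positivity of `a` is encoded as a norm inequality, which a unital contraction transports.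
  have hn : ‖algebraMap ℝ M ‖a‖ - a‖ ≤ ‖a‖ := by
    refine (CStarAlgebra.norm_le_iff_le_algebraMap _ (norm_nonneg a)
      (sub_nonneg.2 hsa.le_algebraMap_norm_self)).2 ?_
    exact sub_le_self _ ha
  have hr : Ψ (algebraMap ℝ M ‖a‖ - a) = algebraMap ℝ N ‖a‖ - Ψ a := by
    rw [map_sub, Algebra.algebraMap_eq_smul_one, Algebra.algebraMap_eq_smul_one,
      ← Complex.coe_smul, ← Complex.coe_smul, map_smul, h1]
  have hx : ‖algebraMap ℝ N ‖a‖ - Ψ a‖ ≤ ‖a‖ := by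
    rw [← hr]; exact (hΨ _).trans hn
  have hxs : IsSelfAdjoint (algebraMap ℝ N ‖a‖ - Ψ a) := by
    rw [← hr]
    exact isSelfAdjoint_map Ψ h1 hΨ ((IsSelfAdjoint.algebraMap M (.all _)).sub hsa)
  have h2 := hxs.le_algebraMap_norm_self.trans (algebraMap_mono N hx)
  exact sub_nonneg.1 ((sub_nonneg.2 h2).trans_eq (by abel))

end UnitalContraction

/-! ### Contractivity from positivity of the amplifications. -/

section Amplification

variable {A B : Type*} [CStarAlgebra A] [PartialOrder A] [StarOrderedRing A]
  [CStarAlgebra B] [PartialOrder B] [StarOrderedRing B] {ι : Type*} [Fintype ι] [DecidableEq ι]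

theorem mapₗ_one (ψ : A →ₗ[ℂ] B) (h1 : ψ 1 = 1) :
    CStarMatrix.mapₗ ψ (1 : CStarMatrix ι ι A) = 1 := by
  ext i j
  change ψ ((1 : CStarMatrix ι ι A) i j) = _
  rw [CStarMatrix.one_apply, CStarMatrix.one_apply]
  split_ifs
  · exact h1
  · exact map_zero ψ

theorem mapₗ_block (ψ : A →ₗ[ℂ] B) (a b c d : CStarMatrix ι ι A) :
    CStarMatrix.mapₗ ψ (block a b c d) =
      block (CStarMatrix.mapₗ ψ a) (CStarMatrix.mapₗ ψ b) (CStarMatrix.mapₗ ψ c)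
        (CStarMatrix.mapₗ ψ d) := by
  ext (i | i) (j | j) <;> rfl

theorem exists_eq_block (E : CStarMatrix (ι ⊕ ι) (ι ⊕ ι) A) :
    ∃ a b c d : CStarMatrix ι ι A, E = block a b c d :=
  ⟨_, _, _, _, (fromBlocks_toBlocks (CStarMatrix.ofMatrix.symm E)).symm⟩

theorem block_inj {a b c d a' b' c' d' : CStarMatrix ι ι A} (h : block a b c d = block a' b' c' d') :
    a = a' ∧ b = b' ∧ c = c' ∧ d = d' :=
  fromBlocks_inj.1 h

theorem nonneg_of_block_nonneg {a b c d : CStarMatrix ι ι A} (h : 0 ≤ block a b c d) : 0 ≤ d := by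
  obtain ⟨E, hE⟩ := nonneg_iff_exists_star_mul_self.1 h
  obtain ⟨p, q, r, s, rfl⟩ := exists_eq_block E
  rw [block_star, block_mul] at hE
  rw [(block_inj hE).2.2.2]
  exact add_nonneg (star_mul_self_nonneg q) (star_mul_self_nonneg s)

/-- A unital linear map whose second amplification is positive is contractive. -/
theorem norm_mapₗ_le_of_positive (ψ : A →ₗ[ℂ] B) (h1 : ψ 1 = 1)
    (hψ : ∀ a : CStarMatrix (ι ⊕ ι) (ι ⊕ ι) A, 0 ≤ a → 0 ≤ CStarMatrix.mapₗ ψ a)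
    {f : CStarMatrix ι ι A} (hf : ‖f‖ ≤ 1) : ‖CStarMatrix.mapₗ ψ f‖ ≤ 1 := by
  obtain ⟨t, ht⟩ := nonneg_iff_exists_star_mul_self.1 (norm_le_one_iff.1 hf)
  -- With `star t * t = 1 - star f * f`, the upper triangular matrix with rows `(1, f)` and `(0, t)`
  -- is a square root.
  have h2 : 0 ≤ block 1 f (star f) 1 := by
    refine nonneg_iff_exists_star_mul_self.2 ⟨block 1 f 0 t, ?_⟩
    rw [block_star, block_mul]
    simp only [star_one, star_zero, one_mul, mul_one, zero_mul, mul_zero, add_zero]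
    rw [← ht, add_sub_cancel]
  have h3 := hψ _ h2
  rw [mapₗ_block, mapₗ_one ψ h1] at h3
  set g := CStarMatrix.mapₗ ψ f
  have h4 : CStarMatrix.mapₗ ψ (star f) = star g := by
    have := (IsSelfAdjoint.of_nonneg h3).star_eq
    rw [block_star] at this
    exact (block_inj this).2.2.1.symm
  rw [h4] at h3
  rw [norm_le_one_iff]
  -- Conjugation by the column `(-g, 1)` leaves the Schur complement `1 - star g * g` in the last
  -- corner.
  have h5 := star_left_conjugate_nonneg h3 (block 0 (-g) 0 1)
  rw [block_star, block_mul, block_mul] at h5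
  refine (nonneg_of_block_nonneg h5).trans_eq ?_
  simp only [star_neg, star_one]
  noncomm_ring

theorem norm_mapₗ_le_norm (ψ : A →ₗ[ℂ] B) (h1 : ψ 1 = 1)
    (hψ : ∀ a : CStarMatrix (ι ⊕ ι) (ι ⊕ ι) A, 0 ≤ a → 0 ≤ CStarMatrix.mapₗ ψ a)
    (f : CStarMatrix ι ι A) : ‖CStarMatrix.mapₗ ψ f‖ ≤ ‖f‖ := by
  rcases eq_or_ne f 0 with rfl | hf
  · rw [map_zero]; simp
  have hf0 : 0 < ‖f‖ := norm_pos_iff.2 hf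
  have hn : ‖(‖f‖ : ℂ)‖ = ‖f‖ := by simp
  have h := norm_mapₗ_le_of_positive ψ h1 hψ (f := (‖f‖ : ℂ)⁻¹ • f) (by
    rw [norm_smul, norm_inv, hn, inv_mul_cancel₀ hf0.ne'])
  rw [map_smul, norm_smul, norm_inv, hn, inv_mul_le_iff₀ hf0, mul_one] at h
  exact h

end Amplification

end OpSp

/-! ### A Hahn–Banach sandwich theorem. -/

/-- A linear functional squeezed between a convex cone of lower bounds and a seminorm. -/
theorem exists_linearMap_le_seminorm_of_cone {E : Type*} [AddCommGroup E] [Module ℝ E]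
    (M : Seminorm ℝ E) (W : Set (E × ℝ)) (h0 : (0, 0) ∈ W)
    (hadd : ∀ v ∈ W, ∀ w ∈ W, v + w ∈ W) (hsmul : ∀ c : ℝ, 0 < c → ∀ w ∈ W, c • w ∈ W)
    (hM : ∀ w ∈ W, w.2 ≤ M w.1) :
    ∃ g : E →ₗ[ℝ] ℝ, (∀ v, g v ≤ M v) ∧ ∀ w ∈ W, w.2 ≤ g w.1 := by
  set S : E → Set ℝ := fun v => (fun w : E × ℝ => M (v + w.1) - w.2) '' W with hS
  have hne : ∀ v, (S v).Nonempty := fun v => ⟨_, _, h0, rfl⟩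
  have hbd : ∀ v, BddBelow (S v) := fun v => by
    refine ⟨-M v, ?_⟩
    rintro _ ⟨w, hw, rfl⟩
    have h1 : M w.1 ≤ M (v + w.1) + M v := by
      have := map_sub_le_add M (v + w.1) v
      rwa [add_sub_cancel_left] at this
    have := hM w hw
    simp only
    linarith
  -- This infimum is sublinear and below `M`. Any functional below it also respects the lower
  -- bounds, as testing at `-w.1` shows.
  set N : E → ℝ := fun v => sInf (S v) with hN
  have hNle : ∀ v, ∀ w ∈ W, N v ≤ M (v + w.1) - w.2 := fun v w hw => csInf_le (hbd v) ⟨w, hw, rfl⟩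
  have hom_le : ∀ c : ℝ, 0 < c → ∀ x, N (c • x) ≤ c * N x := fun c hc x => by
    rw [← div_le_iff₀' hc]
    refine le_csInf (hne x) ?_
    rintro _ ⟨w, hw, rfl⟩
    rw [div_le_iff₀' hc]
    refine (hNle _ _ (hsmul c hc w hw)).trans (le_of_eq ?_)
    simp only [Prod.smul_fst, Prod.smul_snd, ← smul_add, map_smul_eq_mul, Real.norm_eq_abs,
      abs_of_pos hc, smul_eq_mul]
    ring
  obtain ⟨g, -, hg⟩ := exists_extension_of_le_sublinear (⊥ : E →ₗ.[ℝ] ℝ) N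
    (fun c hc x => by
      refine le_antisymm (hom_le c hc x) ?_
      have := hom_le c⁻¹ (inv_pos.2 hc) (c • x)
      rw [smul_smul, inv_mul_cancel₀ hc.ne', one_smul, inv_mul_eq_div, le_div_iff₀' hc] at this
      exact this)
    (fun x y => by
      rw [← sub_le_iff_le_add]
      refine le_csInf (hne x) ?_
      rintro _ ⟨v, hv, rfl⟩
      rw [sub_le_comm]
      refine le_csInf (hne y) ?_
      rintro _ ⟨w, hw, rfl⟩
      have h1 := hNle (x + y) _ (hadd v hv w hw)
      have h2 := map_add_le_add M (x + v.1) (y + w.1)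
      have e : x + y + (v + w).1 = (x + v.1) + (y + w.1) := by
        simp only [Prod.fst_add]; abel
      rw [e, Prod.snd_add] at h1
      simp only
      linarith)
    (fun x => by
      have hx : (x : E) = 0 := (Submodule.mem_bot ℝ).1 x.2
      have : (⊥ : E →ₗ.[ℝ] ℝ) x = 0 := rfl
      rw [this, hx]
      refine le_csInf (hne 0) ?_
      rintro _ ⟨w, hw, rfl⟩
      simpa using hM w hw)
  refine ⟨g, fun v => (hg v).trans ?_, fun w hw => ?_⟩
  · simpa using hNle v _ h0
  · have h1 := (hg (-w.1)).trans (hNle (-w.1) w hw)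
    simp only [map_neg, neg_add_cancel, map_zero] at h1
    linarith

namespace OpSp

open Matrix ScalarMatrix DualAlg

/-! ### The norm of an operator space is determined by its completely bounded functionals -/

/-- The square of the Hilbert–Schmidt norm. -/
def hsq {m n : Type*} [Fintype m] [Fintype n] (a : Matrix m n ℂ) : ℝ := ∑ i, ∑ j, ‖a i j‖ ^ 2

section HilbertSchmidt

variable {m n : Type*} [Fintype m] [Fintype n]

theorem hsq_nonneg (a : Matrix m n ℂ) : 0 ≤ hsq a := by unfold hsq; positivity

theorem trace_mul_conjTranspose (a : Matrix m n ℂ) : (trace (a * aᴴ)).re = hsq a := by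
  simp only [trace, diag_apply, Matrix.mul_apply, conjTranspose_apply, Complex.re_sum, hsq]
  refine Finset.sum_congr rfl fun i _ => Finset.sum_congr rfl fun j _ => ?_
  rw [RCLike.star_def, Complex.mul_conj, Complex.ofReal_re, Complex.normSq_eq_norm_sq]

theorem hsq_smul (z : ℂ) (a : Matrix m n ℂ) : hsq (z • a) = ‖z‖ ^ 2 * hsq a := by
  simp [hsq, mul_pow, Finset.mul_sum]

end HilbertSchmidt

section States

variable {n : Type*} [Fintype n] [DecidableEq n]

open scoped ComplexOrder

/-- A real functional that is positive on rank one projections is given by a density matrix. -/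
theorem exists_posSemidef_of_functional (l : Matrix n n ℂ →ₗ[ℝ] ℝ)
    (hl : ∀ ξ : n → ℂ, 0 ≤ l (vecMulVec ξ (star ξ))) :
    ∃ p : Matrix n n ℂ, p.PosSemidef ∧ ∀ a : Matrix n n ℂ, aᴴ = a → (trace (p * a)).re = l a := by
  set r : Matrix n n ℂ := of fun j i =>
    (l (single i j 1) : ℂ) - Complex.I * (l (single i j Complex.I) : ℂ) with hr
  have h1 : ∀ a, (trace (r * a)).re = l a := fun a => by
    have ha : l a = ∑ i, ∑ j, l (single i j (a i j)) := by
      conv_lhs => rw [matrix_eq_sum_single a]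
      simp
    have hz : ∀ (i j : n) (z : ℂ), l (single i j z) =
        z.re * l (single i j 1) + z.im * l (single i j Complex.I) := fun i j z => by
      rw [← smul_eq_mul, ← smul_eq_mul, ← map_smul, ← map_smul, ← map_add]
      congr 1
      rw [smul_single, smul_single, ← single_add]
      congr 1
      exact Complex.ext (by simp) (by simp)
    rw [ha]
    simp only [trace, diag_apply, Matrix.mul_apply, Complex.re_sum]
    rw [Finset.sum_comm]
    refine Finset.sum_congr rfl fun i _ => Finset.sum_congr rfl fun j _ => ?_
    rw [hz, hr]
    simp
    ring
  -- Taking the hermitian part of `r` does not change the real trace pairing with self-adjoint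
  -- matrices.
  set p : Matrix n n ℂ := (1 / 2 : ℂ) • (r + rᴴ) with hp
  have hpH : pᴴ = p := by
    rw [hp, conjTranspose_smul, conjTranspose_add, conjTranspose_conjTranspose, add_comm]
    simp
  have h2 : ∀ a : Matrix n n ℂ, aᴴ = a → (trace (p * a)).re = l a := fun a ha => by
    have h3 : trace (rᴴ * a) = star (trace (r * a)) := by
      rw [← trace_conjTranspose, conjTranspose_mul, ha, trace_mul_comm]
    rw [hp, smul_mul_assoc, trace_smul, add_mul, trace_add, h3, ← h1 a]
    simp
    ring
  refine ⟨p, .of_dotProduct_mulVec_nonneg hpH fun ξ => ?_, h2⟩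
  have h4 := h2 (vecMulVec ξ (star ξ)) (by ext i j; simp [vecMulVec_apply, mul_comm])
  have h5 : trace (p * vecMulVec ξ (star ξ)) = star ξ ⬝ᵥ p *ᵥ ξ := by
    rw [mul_vecMulVec, trace_vecMulVec, dotProduct_comm]
  have h6 : star (star ξ ⬝ᵥ p *ᵥ ξ) = star ξ ⬝ᵥ p *ᵥ ξ := by
    rw [← star_dotProduct, star_mulVec, hpH, ← dotProduct_mulVec]
  rw [h5] at h4
  rw [Complex.nonneg_iff, h4]
  refine ⟨hl ξ, ?_⟩
  have := congrArg Complex.im h6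
  simp at this
  linarith

open scoped MatrixOrder in
/-- A density matrix is dominated by an invertible positive matrix of nearly the same trace. -/
theorem exists_isUnit_of_posSemidef {p : Matrix n n ℂ} (hp : p.PosSemidef) {ε : ℝ} (hε : 0 < ε) :
    ∃ S : Matrix n n ℂ, IsUnit S.det ∧ Sᴴ * S = p + (ε : ℂ) • 1 := by
  have h1 : ((ε : ℂ) • (1 : Matrix n n ℂ)).PosDef := PosDef.one.smul (by exact_mod_cast hε)
  have h2 : (p + (ε : ℂ) • 1).PosDef := h1.posSemidef_add hp
  obtain ⟨S, hS⟩ := nonneg_iff_exists_star_mul_self.1 h2.posSemidef.nonneg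
  refine ⟨S, ?_, hS.symm⟩
  have h3 := (isUnit_iff_isUnit_det _).1 h2.isUnit
  rw [hS, det_mul] at h3
  exact isUnit_of_mul_isUnit_right h3

end States

section Representation

variable {X : Type*} [AddCommGroup X] [Module ℂ X]

theorem rectMul_smul_left {m n m' n' : ℕ} (z : ℂ) (α : Matrix (Fin n) (Fin m) ℂ)
    (x : Matrix (Fin m) (Fin m') X) (β : Matrix (Fin m') (Fin n') ℂ) :
    rectMul (z • α) x β = z • rectMul α x β := by
  ext i j
  simp [rectMul, Finset.smul_sum, smul_smul, mul_assoc]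

theorem rectMul_smul_right {m n m' n' : ℕ} (z : ℂ) (α : Matrix (Fin n) (Fin m) ℂ)
    (x : Matrix (Fin m) (Fin m') X) (β : Matrix (Fin m') (Fin n') ℂ) :
    rectMul α x (z • β) = z • rectMul α x β := by
  ext i j
  simp only [rectMul, Finset.smul_sum, smul_smul, of_apply, Matrix.smul_apply, smul_eq_mul]
  exact Finset.sum_congr rfl fun k _ => Finset.sum_congr rfl fun l _ => by ring_nf

theorem rectMul_smul_mid {m n m' n' : ℕ} (z : ℂ) (α : Matrix (Fin n) (Fin m) ℂ)
    (x : Matrix (Fin m) (Fin m') X) (β : Matrix (Fin m') (Fin n') ℂ) :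
    rectMul α (z • x) β = z • rectMul α x β := by
  ext i j
  simp only [rectMul, Finset.smul_sum, smul_smul, of_apply, Matrix.smul_apply]
  exact Finset.sum_congr rfl fun k _ => Finset.sum_congr rfl fun l _ => by ring_nf

/-- The matrix `[α₁ α₂]`. -/
def rowAppend {n m₁ m₂ : ℕ} (α : Matrix (Fin n) (Fin m₁) ℂ) (β : Matrix (Fin n) (Fin m₂) ℂ) :
    Matrix (Fin n) (Fin (m₁ + m₂)) ℂ := of fun i => Fin.append (α i) (β i)

/-- The matrix with `α₁` stacked on `α₂`. -/
def colAppend {n m₁ m₂ : ℕ} (α : Matrix (Fin m₁) (Fin n) ℂ) (β : Matrix (Fin m₂) (Fin n) ℂ) :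
    Matrix (Fin (m₁ + m₂)) (Fin n) ℂ := of fun k j => Fin.append (α · j) (β · j) k

theorem rowAppend_mul_conjTranspose {n m₁ m₂ : ℕ} (α : Matrix (Fin n) (Fin m₁) ℂ)
    (β : Matrix (Fin n) (Fin m₂) ℂ) :
    rowAppend α β * (rowAppend α β)ᴴ = α * αᴴ + β * βᴴ := by
  ext i j
  simp [rowAppend, Matrix.mul_apply, Fin.sum_univ_add]

theorem conjTranspose_mul_colAppend {n m₁ m₂ : ℕ} (α : Matrix (Fin m₁) (Fin n) ℂ)
    (β : Matrix (Fin m₂) (Fin n) ℂ) :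
    (colAppend α β)ᴴ * colAppend α β = αᴴ * α + βᴴ * β := by
  ext i j
  simp [colAppend, Matrix.mul_apply, Fin.sum_univ_add]

theorem rectMul_append {n m₁ m₂ : ℕ} (α₁ : Matrix (Fin n) (Fin m₁) ℂ)
    (α₂ : Matrix (Fin n) (Fin m₂) ℂ) (x₁ : Matrix (Fin m₁) (Fin m₁) X)
    (x₂ : Matrix (Fin m₂) (Fin m₂) X) (β₁ : Matrix (Fin m₁) (Fin n) ℂ)
    (β₂ : Matrix (Fin m₂) (Fin n) ℂ) :
    rectMul (rowAppend α₁ α₂) (blockDiag x₁ x₂) (colAppend β₁ β₂) =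
      rectMul α₁ x₁ β₁ + rectMul α₂ x₂ β₂ := by
  ext i j
  simp [rectMul, rowAppend, colAppend, Fin.sum_univ_add, blockDiag_castAdd_castAdd,
    blockDiag_natAdd_natAdd, blockDiag_castAdd_natAdd, blockDiag_natAdd_castAdd]

variable [OperatorSpace X]

/-- The Hahn–Banach theorem for a matrix norm of an operator space. -/
theorem exists_functional_eq_gauge {n : ℕ} (y : Matrix (Fin n) (Fin n) X) :
    ∃ F : Matrix (Fin n) (Fin n) X →ₗ[ℂ] ℂ, (∀ z, ‖F z‖ ≤ gauge X n z) ∧ F y = gauge X n y := by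
  let : Norm (Matrix (Fin n) (Fin n) X) := ⟨gauge X n⟩
  have core : SeminormedSpace.Core ℂ (Matrix (Fin n) (Fin n) X) :=
    { norm_nonneg := gauge_nonneg n
      norm_smul := gauge_smul n
      norm_triangle := gauge_add_le n }
  let : SeminormedAddCommGroup (Matrix (Fin n) (Fin n) X) := .ofCore core
  let : NormedSpace ℂ (Matrix (Fin n) (Fin n) X) := { norm_smul_le := fun z x => (gauge_smul n z x).le }
  obtain ⟨g, hg, hy⟩ := exists_dual_vector'' ℂ y
  exact ⟨g.toLinearMap, fun z => (g.le_of_opNorm_le hg z).trans_eq (one_mul _), hy⟩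

/-- The cone of lower bounds defined by a functional on a matrix space. -/
def boundCone {n : ℕ} (F : Matrix (Fin n) (Fin n) X →ₗ[ℂ] ℂ) :
    Set ((Matrix (Fin n) (Fin n) ℂ × Matrix (Fin n) (Fin n) ℂ) × ℝ) :=
  {w | ∃ (m : ℕ) (α : Matrix (Fin n) (Fin m) ℂ) (x : Matrix (Fin m) (Fin m) X)
    (β : Matrix (Fin m) (Fin n) ℂ), gauge X m x ≤ 1 ∧
      w = ((α * αᴴ, βᴴ * β), 2 * (F (rectMul α x β)).re)}

/-- Ruan's axioms enter here: block sums make the set of lower bounds closed under addition, and `2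
‖α‖ ‖β‖ ≤ ‖α‖² + ‖β‖²` puts them below the seminorm. -/
theorem exists_functionals_of_contractive {n : ℕ} (F : Matrix (Fin n) (Fin n) X →ₗ[ℂ] ℂ)
    (hF : ∀ z, ‖F z‖ ≤ gauge X n z) :
    ∃ g : Matrix (Fin n) (Fin n) ℂ × Matrix (Fin n) (Fin n) ℂ →ₗ[ℝ] ℝ,
      (∀ v, g v ≤ ‖v.1‖ + ‖v.2‖) ∧ ∀ w ∈ boundCone F, w.2 ≤ g w.1 := by
  let M : Seminorm ℝ (Matrix (Fin n) (Fin n) ℂ × Matrix (Fin n) (Fin n) ℂ) :=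
    Seminorm.of (fun v => ‖v.1‖ + ‖v.2‖)
      (fun v w => by
        have h1 := norm_add_le v.1 w.1
        have h2 := norm_add_le v.2 w.2
        simp only [Prod.fst_add, Prod.snd_add]
        linarith)
      (fun c v => by
        simp only [Prod.smul_fst, Prod.smul_snd, norm_smul]
        ring)
  refine exists_linearMap_le_seminorm_of_cone M (boundCone F) ?_ ?_ ?_ ?_
  · refine ⟨0, 0, 0, 0, by rw [gauge_zero]; exact zero_le_one, ?_⟩
    have : rectMul (0 : Matrix (Fin n) (Fin 0) ℂ) (0 : Matrix (Fin 0) (Fin 0) X)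
      (0 : Matrix (Fin 0) (Fin n) ℂ) = 0 := by ext i j; simp [rectMul]
    rw [this]
    simp
    rfl
  · rintro _ ⟨m₁, α₁, x₁, β₁, h₁, rfl⟩ _ ⟨m₂, α₂, x₂, β₂, h₂, rfl⟩
    refine ⟨m₁ + m₂, rowAppend α₁ α₂, blockDiag x₁ x₂, colAppend β₁ β₂, ?_, ?_⟩
    · rw [gauge_blockDiag]; exact max_le h₁ h₂
    · rw [rowAppend_mul_conjTranspose, conjTranspose_mul_colAppend, rectMul_append, map_add,
        Complex.add_re, mul_add]
      rfl
  · rintro c hc _ ⟨m, α, x, β, h, rfl⟩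
    refine ⟨m, (Real.sqrt c : ℂ) • α, x, (Real.sqrt c : ℂ) • β, h, ?_⟩
    have hs : (Real.sqrt c : ℂ) * (Real.sqrt c : ℂ) = (c : ℂ) := by
      rw [← Complex.ofReal_mul, Real.mul_self_sqrt hc.le]
    have hs' : star (Real.sqrt c : ℂ) = (Real.sqrt c : ℂ) := by simp
    rw [rectMul_smul_left, rectMul_smul_right, smul_smul, hs, conjTranspose_smul,
      conjTranspose_smul, Matrix.smul_mul, Matrix.mul_smul, Matrix.smul_mul, Matrix.mul_smul,
      smul_smul, smul_smul, hs', hs, map_smul]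
    refine Prod.ext (Prod.ext ?_ ?_) ?_
    · exact (Complex.coe_smul c (α * αᴴ)).symm
    · exact (Complex.coe_smul c (βᴴ * β)).symm
    · simp; ring
  · rintro _ ⟨m, α, x, β, h, rfl⟩
    have h1 := (hF _).trans (gauge_rectMul_le α x β)
    have h2 := (Complex.re_le_norm (F (rectMul α x β))).trans h1
    have h3 : ‖α * αᴴ‖ = ‖α‖ * ‖α‖ := by
      have := l2_opNorm_conjTranspose_mul_self αᴴ
      rwa [conjTranspose_conjTranspose, l2_opNorm_conjTranspose] at this
    change _ ≤ ‖α * αᴴ‖ + ‖βᴴ * β‖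
    rw [h3, l2_opNorm_conjTranspose_mul_self]
    have h4 : ‖α‖ * gauge X m x * ‖β‖ ≤ ‖α‖ * 1 * ‖β‖ := by gcongr
    simp only
    nlinarith [sq_nonneg (‖α‖ - ‖β‖)]

/-- Lower bounds with `x = 0` make both components of `g` positive, so they are given by positive
matrices `p`, `q`, of trace at most `1` by the upper bound on `g`. Adding `ε` makes them invertible
at a cost of `n * ε` in trace; `S` and `T` are their square-root factors. -/
theorem exists_hilbertSchmidt_bound {n : ℕ} (F : Matrix (Fin n) (Fin n) X →ₗ[ℂ] ℂ)
    (hF : ∀ z, ‖F z‖ ≤ gauge X n z) {ε : ℝ} (hε : 0 < ε) :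
    ∃ S T : Matrix (Fin n) (Fin n) ℂ, IsUnit S.det ∧ IsUnit T.det ∧ hsq S ≤ 1 + n * ε ∧
      hsq T ≤ 1 + n * ε ∧ ∀ (m : ℕ) (α : Matrix (Fin n) (Fin m) ℂ) (x : Matrix (Fin m) (Fin m) X)
        (β : Matrix (Fin m) (Fin n) ℂ), gauge X m x ≤ 1 →
          2 * (F (rectMul α x β)).re ≤ hsq (S * α) + hsq (β * T) := by
  obtain ⟨g, hg1, hg2⟩ := exists_functionals_of_contractive F hF
  have hz : ∀ (m : ℕ), gauge X m 0 ≤ 1 := fun m => by rw [gauge_zero]; exact zero_le_one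
  have hpos1 : ∀ ξ : Fin n → ℂ, 0 ≤ g (vecMulVec ξ (star ξ), 0) := fun ξ => by
    refine hg2 ((vecMulVec ξ (star ξ), 0), 0) ⟨1, of fun i _ => ξ i, 0, 0, hz 1, ?_⟩
    refine Prod.ext (Prod.ext ?_ ?_) ?_
    · ext i j; simp [Matrix.mul_apply, vecMulVec_apply]
    · simp
    · have : rectMul (of fun i _ => ξ i) (0 : Matrix (Fin 1) (Fin 1) X)
        (0 : Matrix (Fin 1) (Fin n) ℂ) = 0 := by ext i j; simp [rectMul]
      rw [this]; simp
  have hpos2 : ∀ ξ : Fin n → ℂ, 0 ≤ g (0, vecMulVec ξ (star ξ)) := fun ξ => by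
    refine hg2 ((0, vecMulVec ξ (star ξ)), 0) ⟨1, 0, 0, of fun _ j => star (ξ j), hz 1, ?_⟩
    refine Prod.ext (Prod.ext ?_ ?_) ?_
    · simp
    · ext i j; simp [Matrix.mul_apply, vecMulVec_apply]
    · have : rectMul (0 : Matrix (Fin n) (Fin 1) ℂ) (0 : Matrix (Fin 1) (Fin 1) X)
        (of fun _ j => star (ξ j)) = 0 := by ext i j; simp [rectMul]
      rw [this]; simp
  obtain ⟨p, hp, hpg⟩ := exists_posSemidef_of_functional (g ∘ₗ LinearMap.inl ℝ _ _) hpos1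
  obtain ⟨q, hq, hqg⟩ := exists_posSemidef_of_functional (g ∘ₗ LinearMap.inr ℝ _ _) hpos2
  have htr : ∀ (r : Matrix (Fin n) (Fin n) ℂ), (trace r).re ≤ 1 →
      (trace (r + (ε : ℂ) • 1)).re ≤ 1 + n * ε := fun r hr => by
    rw [trace_add, trace_smul, trace_one, Fintype.card_fin, Complex.add_re]
    simp only [smul_eq_mul, ← Complex.ofReal_natCast, ← Complex.ofReal_mul, Complex.ofReal_re]
    linarith
  have hptr : (trace p).re ≤ 1 := by
    have h1 := hpg 1 conjTranspose_one
    have h2 := hg1 (1, 0)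
    rw [mul_one] at h1
    rw [h1]
    refine h2.trans ?_
    simpa using norm_one_le
  have hqtr : (trace q).re ≤ 1 := by
    have h1 := hqg 1 conjTranspose_one
    have h2 := hg1 (0, 1)
    rw [mul_one] at h1
    rw [h1]
    refine h2.trans ?_
    simpa using norm_one_le
  obtain ⟨S, hSu, hS⟩ := exists_isUnit_of_posSemidef hp hε
  obtain ⟨R, hRu, hR⟩ := exists_isUnit_of_posSemidef hq hε
  -- The adjoint appears because `T` multiplies `β` on the right, so `T * Tᴴ` has to be `q + ε`.
  refine ⟨S, Rᴴ, hSu, ?_, ?_, ?_, fun m α x β hx => ?_⟩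
  · rw [det_conjTranspose]; exact hRu.star
  · rw [← trace_mul_conjTranspose, trace_mul_comm, hS]; exact htr p hptr
  · rw [← trace_mul_conjTranspose, conjTranspose_conjTranspose, hR]; exact htr q hqtr
  · have h1 := hg2 _ ⟨m, α, x, β, hx, rfl⟩
    refine h1.trans ?_
    have e : g (α * αᴴ, βᴴ * β) = (trace (p * (α * αᴴ))).re + (trace (q * (βᴴ * β))).re := by
      rw [hpg _ (by simp), hqg _ (by simp), LinearMap.comp_apply, LinearMap.comp_apply, ← map_add]
      simp
    have hle : ∀ {k : ℕ} (r : Matrix (Fin n) (Fin n) ℂ) (a : Matrix (Fin n) (Fin k) ℂ),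
        (trace (r * (a * aᴴ))).re ≤ (trace ((r + (ε : ℂ) • 1) * (a * aᴴ))).re := fun r a => by
      rw [add_mul, trace_add, Complex.add_re, smul_mul_assoc, one_mul, trace_smul, smul_eq_mul,
        Complex.re_ofReal_mul, trace_mul_conjTranspose]
      have := hsq_nonneg a
      nlinarith
    rw [e]
    refine add_le_add ((hle p α).trans_eq ?_) ?_
    · rw [← hS, ← trace_mul_conjTranspose (S * α), conjTranspose_mul, Matrix.mul_assoc,
        trace_mul_comm, Matrix.mul_assoc, Matrix.mul_assoc, Matrix.mul_assoc]
    · have := hle q βᴴ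
      rw [conjTranspose_conjTranspose] at this
      refine this.trans_eq ?_
      rw [← hR, ← trace_mul_conjTranspose (β * Rᴴ), conjTranspose_mul, conjTranspose_conjTranspose,
        ← Matrix.mul_assoc, trace_mul_comm, Matrix.mul_assoc, Matrix.mul_assoc]

theorem norm_apply_rectMul_sq_le {n : ℕ} {F : Matrix (Fin n) (Fin n) X →ₗ[ℂ] ℂ}
    {S T : Matrix (Fin n) (Fin n) ℂ}
    (h : ∀ (m : ℕ) (α : Matrix (Fin n) (Fin m) ℂ) (x : Matrix (Fin m) (Fin m) X)
        (β : Matrix (Fin m) (Fin n) ℂ), gauge X m x ≤ 1 →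
          2 * (F (rectMul α x β)).re ≤ hsq (S * α) + hsq (β * T))
    {m : ℕ} (α : Matrix (Fin n) (Fin m) ℂ) (x : Matrix (Fin m) (Fin m) X)
    (β : Matrix (Fin m) (Fin n) ℂ) :
    ‖F (rectMul α x β)‖ ≤ Real.sqrt (hsq (S * α)) * Real.sqrt (hsq (β * T)) * gauge X m x := by
  have key : ∀ x : Matrix (Fin m) (Fin m) X, gauge X m x ≤ 1 →
      ‖F (rectMul α x β)‖ ≤ Real.sqrt (hsq (S * α)) * Real.sqrt (hsq (β * T)) := fun x hx => by
    -- Replacing `α` by `s c α`, with `c` the phase of the value, gives a quadratic in `s` that is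
    -- nonnegative. Its discriminant turns the sum bound into the product bound.
    obtain ⟨c, hc, hcF⟩ := Complex.exists_norm_eq_mul_self (F (rectMul α x β))
    have hA := hsq_nonneg (S * α)
    have hB := hsq_nonneg (β * T)
    have hs : ∀ s : ℝ, 0 ≤ hsq (S * α) * (s * s) + -2 * ‖F (rectMul α x β)‖ * s + hsq (β * T) :=
      fun s => by
        have h1 := h m (((s : ℂ) * c) • α) x β hx
        rw [rectMul_smul_left, map_smul, smul_eq_mul, mul_assoc, ← hcF, ← Complex.ofReal_mul,
          Complex.ofReal_re, Matrix.mul_smul, hsq_smul, norm_mul, hc, mul_one, Complex.norm_real,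
          Real.norm_eq_abs, sq_abs] at h1
        nlinarith
    have hd := discrim_le_zero hs
    rw [discrim] at hd
    rw [← Real.sqrt_mul hA]
    refine Real.le_sqrt_of_sq_le ?_
    nlinarith
  rcases eq_or_lt_of_le (gauge_nonneg m x) with h0 | h0
  · have hx : x = 0 := OperatorSpace.eq_zero_of_matNorm m x h0.symm
    have : rectMul α x β = 0 := by rw [hx]; ext i j; simp [rectMul]
    rw [this, map_zero, norm_zero, ← h0, mul_zero]
  · have hg : ‖((gauge X m x : ℂ))⁻¹‖ = (gauge X m x)⁻¹ := by
      rw [norm_inv, Complex.norm_real, Real.norm_eq_abs, abs_of_pos h0]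
    have h1 := key (((gauge X m x : ℂ))⁻¹ • x) (by
      rw [gauge_smul, hg, inv_mul_cancel₀ h0.ne'])
    rw [rectMul_smul_mid, map_smul, norm_smul, hg, inv_mul_le_iff₀ h0] at h1
    linarith

end Representation

variable {C : Type*} [AddCommGroup C] [Module ℂ C] [FiniteDimensional ℂ C] [VNCoalgebra C]

/-- The matrix norms are determined, up to arbitrarily small error, by matrices of functionals. -/
theorem exists_isCB_gauge_le {n : ℕ} (y : Matrix (Fin n) (Fin n) C) {ε : ℝ} (hε : 0 < ε) :
    ∃ f : CStarMatrix (Fin n) (Fin n) (DualAlg C), IsCB f 1 ∧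
      gauge C n y ≤ (1 + n * ε) * ‖amp f y‖ := by
  obtain ⟨F, hF, hFy⟩ := exists_functional_eq_gauge y
  obtain ⟨S, T, hS, hT, hS1, hT1, hST⟩ := exists_hilbertSchmidt_bound F hF hε
  have hb := @norm_apply_rectMul_sq_le C _ _ _ n F S T hST
  -- Dividing `F` by `S` and `T` makes the Hilbert–Schmidt estimate say exactly that the
  -- sesquilinear form of `amp f x` is bounded by `gauge C m x`.
  let f : CStarMatrix (Fin n) (Fin n) (DualAlg C) := CStarMatrix.ofMatrix (of fun r c =>
    toDual.symm (F ∘ₗ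
      { toFun := fun x => of fun i j => (S⁻¹ i r * T⁻¹ c j) • x
        map_add' := fun x x' => by ext i j; simp
        map_smul' := fun z x => by ext i j; simp [smul_smul, mul_comm] }))
  have hf : ∀ r c x, toDual (f r c) x = F (of fun i j => (S⁻¹ i r * T⁻¹ c j) • x) :=
    fun r c x => rfl
  have hexp : ∀ {m : ℕ} (a : Matrix (Fin n) (Fin m) ℂ) (x : Matrix (Fin m) (Fin m) C)
      (b : Matrix (Fin m) (Fin n) ℂ), F (rectMul (S⁻¹ * a) x (b * T⁻¹)) =
        ∑ p : Fin m × Fin n, ∑ q : Fin m × Fin n, a p.2 p.1 * amp f x p q * b q.1 q.2 := by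
    intro m a x b
    have e : rectMul (S⁻¹ * a) x (b * T⁻¹) = ∑ k, ∑ r, ∑ l, ∑ c, (a r k * b l c) •
        (of fun i j => (S⁻¹ i r * T⁻¹ c j) • x k l : Matrix (Fin n) (Fin n) C) := by
      ext i j
      simp only [rectMul, of_apply, Matrix.sum_apply, Matrix.smul_apply, smul_smul]
      refine Finset.sum_congr rfl fun k _ => ?_
      rw [Finset.sum_comm]
      refine Finset.sum_congr rfl fun l _ => ?_
      rw [Matrix.mul_apply, Matrix.mul_apply, Finset.sum_mul_sum, Finset.sum_smul]
      refine Finset.sum_congr rfl fun r _ => ?_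
      rw [Finset.sum_smul]
      exact Finset.sum_congr rfl fun c _ => by ring_nf
    rw [e]
    simp only [map_sum, map_smul, smul_eq_mul, Fintype.sum_prod_type, amp_apply, hf]
    refine Finset.sum_congr rfl fun k _ => Finset.sum_congr rfl fun r _ =>
      Finset.sum_congr rfl fun l _ => Finset.sum_congr rfl fun c _ => by ring
  have hnorm : ∀ {m : ℕ} (v : EuclideanSpace ℂ (Fin m × Fin n)),
      Real.sqrt (∑ p : Fin n, ∑ q : Fin m, ‖v (q, p)‖ ^ 2) = ‖v‖ := fun v => by
    rw [EuclideanSpace.norm_eq, Fintype.sum_prod_type, Finset.sum_comm]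
  refine ⟨f, fun m x => ?_, ?_⟩
  · rw [one_mul]
    refine norm_le_of_forall_sesq_le _ (gauge_nonneg m x) fun v w => ?_
    have h1 := hb (S⁻¹ * of fun r k => star (v (k, r))) x ((of fun l c => w (l, c)) * T⁻¹)
    rw [hexp, ← Matrix.mul_assoc, Matrix.mul_assoc _ T⁻¹ T, mul_nonsing_inv S hS,
      nonsing_inv_mul T hT, Matrix.one_mul, Matrix.mul_one] at h1
    refine h1.trans (le_of_eq ?_)
    have e1 : Real.sqrt (hsq (of fun (r : Fin n) (k : Fin m) => star (v (k, r)))) = ‖v‖ := by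
      rw [← hnorm]; simp [hsq]
    have e2 : Real.sqrt (hsq (of fun (l : Fin m) (c : Fin n) => w (l, c))) = ‖w‖ := by
      rw [← hnorm, hsq, Finset.sum_comm]; simp
    rw [e1, e2]
    ring
  -- The entries of `S` and `T`, read as vectors, undo the division and recover `F y`; their squared
  -- norms are at most `1 + n * ε`.
  · set v : EuclideanSpace ℂ (Fin n × Fin n) := WithLp.toLp 2 fun p => star (S p.2 p.1) with hv
    set w : EuclideanSpace ℂ (Fin n × Fin n) := WithLp.toLp 2 fun p => T p.1 p.2 with hw
    have h1 := norm_sesq_le (amp f y) v w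
    have e : ∑ p, ∑ q, star (v p) * amp f y p q * w q = F y := by
      have h2 := hexp S y T
      rw [nonsing_inv_mul S hS, mul_nonsing_inv T hT] at h2
      have h3 : rectMul 1 y 1 = y := by ext i j; simp [rectMul, one_apply]
      rw [h3] at h2
      rw [h2]
      simp [hv, hw]
    have hr : ∀ r : ℝ, 0 ≤ r → r ≤ 1 + n * ε → Real.sqrt r ≤ Real.sqrt (1 + n * ε) :=
      fun r _ h => Real.sqrt_le_sqrt h
    have e1 : ‖v‖ ≤ Real.sqrt (1 + n * ε) := by
      rw [← hnorm]
      refine (le_of_eq ?_).trans (hr _ (hsq_nonneg S) hS1)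
      simp [hsq, hv]
    have e2 : ‖w‖ ≤ Real.sqrt (1 + n * ε) := by
      rw [← hnorm]
      refine (le_of_eq ?_).trans (hr _ (hsq_nonneg T) hT1)
      rw [hsq, Finset.sum_comm]
    rw [e, hFy, Complex.norm_real, Real.norm_eq_abs, abs_of_nonneg (gauge_nonneg n y)] at h1
    have hpos : (0 : ℝ) ≤ 1 + n * ε := by positivity
    calc _ ≤ ‖amp f y‖ * ‖v‖ * ‖w‖ := h1
      _ ≤ ‖amp f y‖ * Real.sqrt (1 + n * ε) * Real.sqrt (1 + n * ε) := by gcongr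
      _ = (1 + n * ε) * ‖amp f y‖ := by rw [mul_assoc, Real.mul_self_sqrt hpos, mul_comm]

/-! ### Positive functionals on `T_n ⊗ C` -/

section TraceClass

variable {C : Type*} [AddCommGroup C] [Module ℂ C] [FiniteDimensional ℂ C] [VNCoalgebra C]
variable {n : ℕ}

/-- The matrix of functionals on `C` corresponding to a functional on `T_n ⊗ C`. -/
def functionalMatrix (a : TraceClass n ⊗[ℂ] C →ₗ[ℂ] ℂ) :
    CStarMatrix (Fin n) (Fin n) (DualAlg C) :=
  -- The indices are exchanged so that `e_ij ↦ ∑ k, e_kj ⊗ e_ik` dualises to the usual matrix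
  -- product.
  CStarMatrix.ofMatrix (of fun i j =>
    toDual.symm (a ∘ₗ TensorProduct.mk ℂ (TraceClass n) C (TraceClass.unit j i)))

theorem toDual_functionalMatrix (a : TraceClass n ⊗[ℂ] C →ₗ[ℂ] ℂ) (i j : Fin n) (c : C) :
    toDual (functionalMatrix a i j) c = a (TraceClass.unit j i ⊗ₜ[ℂ] c) := rfl

theorem functionalMatrix_injective :
    Function.Injective (functionalMatrix (C := C) (n := n)) := fun a b h => by
  refine TensorProduct.ext ((TraceClass.basis n).ext fun p => LinearMap.ext fun c => ?_)
  have h1 := congrArg (fun M : CStarMatrix (Fin n) (Fin n) (DualAlg C) => toDual (M p.2 p.1) c) h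
  simp only [toDual_functionalMatrix] at h1
  simpa [TraceClass.basis_apply] using h1

theorem functionalMatrix_surjective :
    Function.Surjective (functionalMatrix (C := C) (n := n)) := fun M => by
  refine ⟨TensorProduct.lift ((TraceClass.basis n).constr ℂ fun p => toDual (M p.2 p.1)), ?_⟩
  ext i j
  refine DualAlg.ext_apply fun c => ?_
  rw [toDual_functionalMatrix, TensorProduct.lift.tmul]
  have h := (TraceClass.basis n).constr_basis ℂ (fun p => toDual (M p.2 p.1)) (j, i)
  rw [TraceClass.basis_apply] at h
  rw [h]

theorem coinv_unit_tmul (i j : Fin n) (c : C) :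
    CoInvolution.coinv (TraceClass.unit i j ⊗ₜ[ℂ] c) =
      TraceClass.unit j i ⊗ₜ[ℂ] CoInvolution.coinv c := by
  change TensorProduct.map CoInvolution.coinv CoInvolution.coinv (TraceClass.unit i j ⊗ₜ[ℂ] c) = _
  rw [TensorProduct.map_tmul]
  congr 1
  change (single i j (1 : ℂ))ᴴ = single j i 1
  rw [conjTranspose_single, star_one]

theorem functionalMatrix_coSquare (a : TraceClass n ⊗[ℂ] C →ₗ[ℂ] ℂ) :
    functionalMatrix (coSquare a) = star (functionalMatrix a) * functionalMatrix a := by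
  ext j i
  refine DualAlg.ext_apply fun c => ?_
  rw [toDual_functionalMatrix, CStarMatrix.mul_apply, map_sum, LinearMap.sum_apply]
  simp only [CStarMatrix.star_apply, DualAlg.toDual_mul]
  simp only [coSquare, LinearMap.comp_apply, LinearEquiv.coe_coe]
  rw [TensorProduct.comul_tmul, TraceClass.comul_unit]
  induction (CoalgebraStruct.comul c : C ⊗[ℂ] C) with
  | zero => simp
  | add s t hs ht =>
    simp only [TensorProduct.tmul_add, map_add, hs, ht, Finset.sum_add_distrib]
  | tmul x y =>
    simp only [TensorProduct.sum_tmul, map_sum,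
      TensorProduct.AlgebraTensorModule.tensorTensorTensorComm_tmul, TensorProduct.comm_tmul,
      TensorProduct.map_tmul, LinearMap.mul'_apply, toDual_star, toDual_functionalMatrix]
    refine Finset.sum_congr rfl fun k _ => ?_
    rw [LinearMap.comp_apply, LinearMap.comp_apply, coinv_unit_tmul, mul_comm]
    rfl

/-- Both sides ask for a factorisation `star b * b`, and every matrix `b` comes from a functional.
-/
theorem isPositiveFunctional_iff (p : TraceClass n ⊗[ℂ] C →ₗ[ℂ] ℂ) :
    IsPositiveFunctional p ↔ 0 ≤ functionalMatrix p := by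
  rw [nonneg_iff_exists_star_mul_self]
  constructor
  · rintro ⟨a, rfl⟩
    exact ⟨_, functionalMatrix_coSquare a⟩
  · rintro ⟨b, hb⟩
    obtain ⟨a, rfl⟩ := functionalMatrix_surjective b
    exact ⟨a, functionalMatrix_injective (hb.trans (functionalMatrix_coSquare a).symm)⟩

end TraceClass

/-! ### Completely positive and completely contractive maps -/

section Maps

variable {C D : Type*} [AddCommGroup C] [Module ℂ C] [FiniteDimensional ℂ C] [VNCoalgebra C]
  [AddCommGroup D] [Module ℂ D] [FiniteDimensional ℂ D] [VNCoalgebra D] {φ : C →ₗ[ℂ] D}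

/-- Precomposition of functionals with a linear map. -/
def dualMap (φ : C →ₗ[ℂ] D) : DualAlg D →ₗ[ℂ] DualAlg C :=
  toDual.symm.toLinearMap ∘ₗ φ.dualMap ∘ₗ toDual.toLinearMap

theorem dualMap_one (hφ : IsTracePreserving φ) : dualMap φ 1 = 1 :=
  DualAlg.ext_apply fun c => hφ c

theorem functionalMatrix_comp_lTensor {n : ℕ} (φ : C →ₗ[ℂ] D)
    (p : TraceClass n ⊗[ℂ] D →ₗ[ℂ] ℂ) :
    functionalMatrix (p ∘ₗ φ.lTensor (TraceClass n)) =
      CStarMatrix.mapₗ (dualMap φ) (functionalMatrix p) := rfl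

theorem isCompletelyPositive_iff (φ : C →ₗ[ℂ] D) : IsCompletelyPositive φ ↔
    ∀ (n : ℕ) (a : CStarMatrix (Fin n) (Fin n) (DualAlg D)), 0 ≤ a →
      0 ≤ CStarMatrix.mapₗ (dualMap φ) a := by
  constructor
  · intro h n a ha
    obtain ⟨p, rfl⟩ := functionalMatrix_surjective a
    have := h n p ((isPositiveFunctional_iff p).2 ha)
    rwa [isPositiveFunctional_iff, functionalMatrix_comp_lTensor] at this
  · intro h n p hp
    rw [isPositiveFunctional_iff, functionalMatrix_comp_lTensor]
    exact h n _ ((isPositiveFunctional_iff p).1 hp)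

theorem reindexₐ_nonneg {A : Type*} [CStarAlgebra A] [PartialOrder A] [StarOrderedRing A]
    {ι κ : Type*} [Fintype ι] [DecidableEq ι] [Fintype κ] [DecidableEq κ] (e : ι ≃ κ)
    {a : CStarMatrix ι ι A} (ha : 0 ≤ a) : 0 ≤ CStarMatrix.reindexₐ ℂ A e a := by
  obtain ⟨b, rfl⟩ := nonneg_iff_exists_star_mul_self.1 ha
  exact nonneg_iff_exists_star_mul_self.2 ⟨CStarMatrix.reindexₐ ℂ A e b, by
    rw [map_mul, map_star]⟩

/-- General index types are needed because the contractivity argument doubles the index set to `ι ⊕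
ι`. -/
theorem IsCompletelyPositive.mapₗ_nonneg (h : IsCompletelyPositive φ) {ι : Type*} [Fintype ι]
    [DecidableEq ι] {a : CStarMatrix ι ι (DualAlg D)} (ha : 0 ≤ a) :
    0 ≤ CStarMatrix.mapₗ (dualMap φ) a := by
  have e := Fintype.equivFin ι
  have h1 := (isCompletelyPositive_iff φ).1 h _ _ (reindexₐ_nonneg e ha)
  have h2 := reindexₐ_nonneg e.symm h1
  convert h2 using 1
  rw [CStarMatrix.mapₗ_reindexₐ]
  ext i j
  simp

theorem amp_mapₗ_dualMap {ι : Type*} [Fintype ι] [DecidableEq ι] (φ : C →ₗ[ℂ] D)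
    (f : CStarMatrix ι ι (DualAlg D)) {m : ℕ} (x : Matrix (Fin m) (Fin m) C) :
    amp (CStarMatrix.mapₗ (dualMap φ) f) x = amp f (x.map φ) := rfl

theorem IsCompletelyContractive.norm_mapₗ_le (h : IsCompletelyContractive φ) {ι : Type*}
    [Fintype ι] [DecidableEq ι] (f : CStarMatrix ι ι (DualAlg D)) :
    ‖CStarMatrix.mapₗ (dualMap φ) f‖ ≤ ‖f‖ := by
  refine norm_le_of_isCB (norm_nonneg f) fun m x => ?_
  rw [amp_mapₗ_dualMap]
  refine ((isCB_iff_norm_le (norm_nonneg f)).2 le_rfl m _).trans ?_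
  gcongr
  exact h m x

/-- A matrix `f` that almost norms `x.map φ` is pulled back to a C⋆-contraction, hence to a cb
contraction that can be tested on `x`. -/
theorem isCompletelyContractive_of_norm_mapₗ_le
    (h : ∀ (n : ℕ) (f : CStarMatrix (Fin n) (Fin n) (DualAlg D)),
      ‖CStarMatrix.mapₗ (dualMap φ) f‖ ≤ ‖f‖) : IsCompletelyContractive φ := by
  intro m x
  have key : ∀ ε : ℝ, 0 < ε → gauge D m (x.map φ) ≤ (1 + m * ε) * gauge C m x := fun ε hε => by
    obtain ⟨f, hf, hy⟩ := exists_isCB_gauge_le (x.map φ) hε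
    refine hy.trans ?_
    have h1 := (isCB_iff_norm_le zero_le_one).2 ((h m f).trans (norm_le_of_isCB zero_le_one hf)) m x
    rw [amp_mapₗ_dualMap, one_mul] at h1
    gcongr
  have hlim : Filter.Tendsto (fun ε : ℝ => (1 + m * ε) * gauge C m x)
      (nhdsWithin 0 (Set.Ioi 0)) (nhds (gauge C m x)) := by
    have : Filter.Tendsto (fun ε : ℝ => (1 + m * ε) * gauge C m x) (nhds 0)
        (nhds ((1 + m * 0) * gauge C m x)) :=
      (Continuous.tendsto (by fun_prop) 0)
    rw [mul_zero, add_zero, one_mul] at this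
    exact this.mono_left nhdsWithin_le_nhds
  exact ge_of_tendsto hlim (by filter_upwards [self_mem_nhdsWithin] with ε hε using key ε hε)

end Maps

end OpSp

end

theorem mainTheorem6 {C₁ C₂ : Type*}
    [AddCommGroup C₁] [Module ℂ C₁] [FiniteDimensional ℂ C₁] [OpSp.VNCoalgebra C₁]
    [AddCommGroup C₂] [Module ℂ C₂] [FiniteDimensional ℂ C₂] [OpSp.VNCoalgebra C₂]
    (φ : C₁ →ₗ[ℂ] C₂) (hφ : OpSp.IsTracePreserving φ) :
    OpSp.IsCompletelyPositive φ ↔ OpSp.IsCompletelyContractive φ := by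
  have h1 := OpSp.dualMap_one hφ
  constructor
  · intro h
    exact OpSp.isCompletelyContractive_of_norm_mapₗ_le fun n f =>
      OpSp.norm_mapₗ_le_norm _ h1 (fun a ha => h.mapₗ_nonneg ha) f
  · intro h
    rw [OpSp.isCompletelyPositive_iff]
    exact fun n a ha => OpSp.map_nonneg_of_contractive (CStarMatrix.mapₗ (OpSp.dualMap φ))
      (OpSp.mapₗ_one _ h1) h.norm_mapₗ_le ha
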